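/- **Setting.** Let $\alpha>1$ and let $\gamma=(\gamma_u)$ be positive weights, indexed by the finite subsets $u\subset\mathbb N=\{1,2,\dots\}$, with $\gamma_\emptyset=1$. Write $\zeta(x)=\sum_{k\ge1}k^{-x}$ for $x>1$ and $\{1:s\}=\{1,\dots,s\}$. For $s\ge1$ and $h\in\mathbb Z^s$ put $\operatorname{supp}(h)=\{j: h_j\ne0\}$ and $$r(h)=\frac1{\gamma_{\operatorname{supp}(h)}}\prod_{j\in\operatorname{supp}(h)}|h_j|^\alpha .$$ Let $H=H_{s,\alpha,\gamma}$ be the space of real-valued functions $f$ on $[0,1]^s$, 1-periodic in each variable, with absolutely convergent Fourier series $f(y)=\sum_{h\in\mathbb Z^s}\widehat f(h)e^{2\pi i h\cdot y}$ and $\|f\|_H:=\big(\sum_h r(h)|\widehat f(h)|^2\big)^{1/2}<\infty$. Its reproducing kernel is $$K(y,y')=\sum_{u\subseteq\{1:s\}}\gamma_u\prod_{j\in u}\eta_\alpha(y_j-y_j'),\qquad \eta_\alpha(x)=\sum_{h\in\mathbb Z\setminus\{0\}}\frac{\cos(2\pi hx)}{|h|^{\alpha}} .$$ For $z\in\{1,\dots,n-1\}^s$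 let $t_k=\{kz/n\}$ (componentwise fractional parts), $k=1,\dots,n$. The kernel interpolant $A_n^*(f)=f_n$ of $f\in H$ is the function of the form $f_n=\sum_{k=1}^n a_kK(t_k,\cdot)$ with real $a_k$ and $f_n(t_k)=f(t_k)$ for $k=1,\dots,n$; its worst case $L_2$ error is $$e^{\rm wor}(A_n^*;L_2)=\sup_{f\in H,\ \|f\|_H\le1}\|f-A_n^*(f)\|_{L_2([0,1]^s)} .$$ The search criterion is $$\mathcal S_s(z)=\sum_{h\in\mathbb Z^s}\frac1{r(h)}\sum_{\substack{\ell\in\mathbb Z^s\setminus\{0\}\\ \ell\cdot z\equiv0\ (\mathrm{mod}\ n)}}\frac1{r(h+\ell)}=\sum_{j=1}^sT_j(z_1,\dots,z_j),$$ where $T_j$ is the part of the sum with $\ell_j\ne0$ and $\ell_i=0$ for all $i>j$. The component-by-component (CBC) construction with criterion $\mathcal S_s$ chooses, for $j=1,\dots,s$ in turn and with $z_1,\dots,z_{j-1}$ fixed, some $z_j\in\{1,\dots,n-1\}$ that minimizes $T_j(z_1,\dots,z_{j-1},z_j)$. **Theorem.** (1) Let $s\ge1$, let $n$ be prime, and let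 $z$ be obtained from the CBC construction. Then the kernel interpolant $A_n^*(f)$ exists and is unique for every $f\in H$, and for all $\lambda\in(\frac1\alpha,1]$ $$e^{\rm wor}(A_n^*;L_2)\le\sqrt2\,[\mathcal S_s(z)]^{1/4}\le\frac{\kappa}{n^{1/(4\lambda)}}\Big(\sum_{u\subseteq\{1:s\}}\max(|u|,1)\,\gamma_u^\lambda\,[2\zeta(\alpha\lambda)]^{|u|}\Big)^{1/(2\lambda)},$$ where $\kappa=\sqrt2\,[\max(6,\,2.5+2^{2\alpha\lambda+1})]^{1/(4\lambda)}$. (2) Let $\delta\in(0,\alpha/4)$. For every $s\ge1$ there is a constant $C$ such that $e^{\rm wor}(A_n^*;L_2)\le C\,n^{-\alpha/4+\delta}$ for all primes $n$ and all $z$ obtained from the CBC construction. With $\lambda_\delta:=\min\big(\tfrac1{\alpha-4\delta},1\big)$ (so that $\lambda_\delta=\frac1{\alpha-4\delta}$ if $\delta\le\frac{\alpha-1}4$), the constant $C$ can be chosen independently of $s$ provided that $$\sum_{\substack{u\subset\mathbb N\\|u|<\infty}}\max(|u|,1)\,\gamma_u^{\lambda_\delta}\,[2\zeta(\alpha\lambda_\delta)]^{|u|}<\infty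 .$$ -/

import Mathlib

noncomputable section

namespace LatticeKernel

/-- The finite subset of `ℕ` that corresponds to a set of coordinates. The coordinates
`1, …, s` are labelled `0, …, s - 1`, so `{1:s}` is `Finset.range s` and `ℕ = {0, 1, 2, …}`
labels the coordinates of all dimensions at once. -/
def coordSet {s : ℕ} (u : Finset (Fin s)) : Finset ℕ := u.map Fin.valEmbedding

/-- `r(h) = γ_{supp h}⁻¹ ∏_{j ∈ supp h} |h_j|^α`. -/
def r (α : ℝ) (γ : Finset ℕ → ℝ) {s : ℕ} (h : Fin s → ℤ) : ℝ :=
  (γ (coordSet {j | h j ≠ 0}))⁻¹ * ∏ j ∈ ({j | h j ≠ 0} : Finset (Fin s)), |(h j : ℝ)| ^ α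

/-- The Fourier coefficient `f̂(h) = ∫_{[0,1]^s} f(y) e^{-2πi h·y} dy` of a real-valued
1-periodic function, that is, of a function on the torus `(ℝ/ℤ)^s`. -/
def fhat {s : ℕ} (f : UnitAddTorus (Fin s) → ℝ) (h : Fin s → ℤ) : ℂ :=
  UnitAddTorus.mFourierCoeff (fun y => (f y : ℂ)) h

/-- Membership in the weighted space `H = H_{s,α,γ}`: the Fourier series of `f` converges
absolutely, represents `f` at every point, and `∑_h r(h) |f̂(h)|² < ∞`. -/
structure MemH (α : ℝ) (γ : Finset ℕ → ℝ) {s : ℕ} (f : UnitAddTorus (Fin s) → ℝ) : Prop where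
  summable_fhat : Summable fun h : Fin s → ℤ => ‖fhat f h‖
  hasSum_fourier : ∀ y : UnitAddTorus (Fin s),
    HasSum (fun h : Fin s → ℤ => fhat f h * UnitAddTorus.mFourier h y) (f y : ℂ)
  summable_norm : Summable fun h : Fin s → ℤ => r α γ h * ‖fhat f h‖ ^ 2

/-- The norm of `H_{s,α,γ}`. -/
def normH (α : ℝ) (γ : Finset ℕ → ℝ) {s : ℕ} (f : UnitAddTorus (Fin s) → ℝ) : ℝ :=
  √(∑' h : Fin s → ℤ, r α γ h * ‖fhat f h‖ ^ 2)

/-- `η_α(x) = ∑_{h ≠ 0} cos(2πhx) / |h|^α`; here `fourier h x = e^{2πihx}`. -/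
def eta (α : ℝ) (x : UnitAddCircle) : ℝ :=
  ∑' h : {h : ℤ // h ≠ 0}, (fourier (T := 1) (h : ℤ) x).re / |((h : ℤ) : ℝ)| ^ α

/-- The reproducing kernel `K(y, y') = ∑_{u ⊆ {1:s}} γ_u ∏_{j ∈ u} η_α(y_j - y'_j)`. -/
def kernel (α : ℝ) (γ : Finset ℕ → ℝ) {s : ℕ} (y y' : UnitAddTorus (Fin s)) : ℝ :=
  ∑ u : Finset (Fin s), γ (coordSet u) * ∏ j ∈ u, eta α (y j - y' j)

/-- The lattice points `t_k = {k z / n}`, `k = 1, …, n` (the index `k : Fin n` stands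
for `k + 1`; the fractional part is taken by passing to `ℝ/ℤ`). -/
def latticePoint {s : ℕ} (n : ℕ) (z : Fin s → ℕ) (k : Fin n) : UnitAddTorus (Fin s) :=
  fun j => ((((k : ℕ) + 1 : ℝ) * (z j : ℝ) / (n : ℝ) : ℝ) : UnitAddCircle)

/-- `g` has the form `∑_k a_k K(t_k, ·)` and interpolates `f` at all lattice points. -/
def IsKernelInterpolant (α : ℝ) (γ : Finset ℕ → ℝ) {s : ℕ} (n : ℕ) (z : Fin s → ℕ)
    (f g : UnitAddTorus (Fin s) → ℝ) : Prop :=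
  (∃ a : Fin n → ℝ, ∀ y, g y = ∑ k, a k * kernel α γ (latticePoint n z k) y) ∧
    ∀ k, g (latticePoint n z k) = f (latticePoint n z k)

/-- The matrix `𝒦_{k,k'} = K(t_k, t_{k'})`. -/
def kernelMatrix (α : ℝ) (γ : Finset ℕ → ℝ) {s : ℕ} (n : ℕ) (z : Fin s → ℕ) :
    Matrix (Fin n) (Fin n) ℝ :=
  Matrix.of fun k k' => kernel α γ (latticePoint n z k) (latticePoint n z k')

/-- The kernel interpolant `A*_n(f) = f_n = ∑_k a_k K(t_k, ·)`, where the coefficients solve the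
linear system `𝒦 a = (f(t_1), …, f(t_n))`. -/
def kernelInterpolant (α : ℝ) (γ : Finset ℕ → ℝ) {s : ℕ} (n : ℕ) (z : Fin s → ℕ)
    (f : UnitAddTorus (Fin s) → ℝ) : UnitAddTorus (Fin s) → ℝ :=
  fun y => ∑ k, ((kernelMatrix α γ n z)⁻¹.mulVec fun k' => f (latticePoint n z k')) k *
    kernel α γ (latticePoint n z k) y

/-- The worst case `L₂` error `sup {‖f - A(f)‖_{L₂} : f ∈ H, ‖f‖_H ≤ 1}` (in `[0, ∞]`). The
volume on the torus is the Lebesgue measure of `[0,1]^s`. -/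
def worstCaseError (α : ℝ) (γ : Finset ℕ → ℝ) {s : ℕ}
    (A : (UnitAddTorus (Fin s) → ℝ) → (UnitAddTorus (Fin s) → ℝ)) : ENNReal :=
  ⨆ (f : UnitAddTorus (Fin s) → ℝ) (_ : MemH α γ f) (_ : normH α γ f ≤ 1),
    MeasureTheory.eLpNorm (fun y => f y - A f y) 2 MeasureTheory.volume

/-- Nonzero elements of the dual lattice: `ℓ ≠ 0` and `ℓ·z ≡ 0 (mod n)`. -/
def IsDual {s : ℕ} (n : ℕ) (z : Fin s → ℕ) (l : Fin s → ℤ) : Prop :=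
  l ≠ 0 ∧ (n : ℤ) ∣ ∑ j, l j * (z j : ℤ)

/-- The search criterion
`𝒮_s(z) = ∑_{h ∈ ℤ^s} 1/r(h) ∑_{ℓ ∈ ℤ^s ∖ {0}, ℓ·z ≡ 0 (mod n)} 1/r(h + ℓ)`. -/
def searchCriterion (α : ℝ) (γ : Finset ℕ → ℝ) {s : ℕ} (n : ℕ) (z : Fin s → ℕ) : ENNReal :=
  ∑' (h : Fin s → ℤ) (l : {l : Fin s → ℤ // IsDual n z l}),
    ENNReal.ofReal ((r α γ h)⁻¹ * (r α γ (h + (l : Fin s → ℤ)))⁻¹)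

/-- The part of `𝒮_s(z)` that comes from those `ℓ` whose last nonzero component is the `j`-th.
It depends on `z_1, …, z_j` only, and the sum of these parts over `j` is `𝒮_s(z)`. -/
def partialCriterion (α : ℝ) (γ : Finset ℕ → ℝ) {s : ℕ} (n : ℕ) (z : Fin s → ℕ) (j : Fin s) :
    ENNReal :=
  ∑' (h : Fin s → ℤ)
    (l : {l : Fin s → ℤ // IsDual n z l ∧ l j ≠ 0 ∧ ∀ i, j < i → l i = 0}),
    ENNReal.ofReal ((r α γ h)⁻¹ * (r α γ (h + (l : Fin s → ℤ)))⁻¹)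

/-- `z` is an output of the component-by-component construction with criterion `𝒮_s`: for
`j = 1, …, s` in turn, with `z_1, …, z_{j-1}` already fixed, `z_j ∈ {1, …, n-1}` is a minimizer
of the part of `𝒮_s` that is determined by `z_1, …, z_j` and involves `z_j`. -/
def IsCBC (α : ℝ) (γ : Finset ℕ → ℝ) {s : ℕ} (n : ℕ) (z : Fin s → ℕ) : Prop :=
  ∀ j, z j ∈ Finset.Icc 1 (n - 1) ∧ ∀ c ∈ Finset.Icc 1 (n - 1),
    partialCriterion α γ n z j ≤ partialCriterion α γ n (Function.update z j c) j

/-- `ζ(x) = ∑_{k ≥ 1} k^{-x}`, for `x > 1`. -/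
def zeta (x : ℝ) : ℝ := ∑' k : ℕ, ((k : ℝ) + 1) ^ (-x)

/-- The summand `max(|u|,1) γ_u^λ [2ζ(αλ)]^{|u|}`. -/
def weightTerm (α : ℝ) (γ : Finset ℕ → ℝ) (lam : ℝ) (u : Finset ℕ) : ℝ :=
  (max u.card 1 : ℕ) * γ u ^ lam * (2 * zeta (α * lam)) ^ u.card

/-- `κ = √2 [max(6, 2.5 + 2^{2αλ+1})]^{1/(4λ)}`. -/
def kappa (α lam : ℝ) : ℝ :=
  √2 * (max 6 (5 / 2 + (2 : ℝ) ^ (2 * α * lam + 1))) ^ (1 / (4 * lam))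

end LatticeKernel

end

open scoped ENNReal ComplexConjugate
open MeasureTheory

namespace LatticeKernel

theorem tsum_pi_prod_ennreal {s : ℕ} (f : Fin s → ℤ → ℝ≥0∞) :
    ∑' h : Fin s → ℤ, ∏ i, f i (h i) = ∏ i, ∑' m, f i m := by
  induction s with
  | zero => simp
  | succ s ih =>
    rw [← (Fin.consEquiv fun _ : Fin (s + 1) => ℤ).tsum_eq, ENNReal.tsum_prod', Fin.prod_univ_succ,
      ← ih, ← ENNReal.tsum_mul_right]
    refine tsum_congr fun m => ?_
    rw [← ENNReal.tsum_mul_left]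
    exact tsum_congr fun h => by simp [Fin.prod_univ_succ, Fin.consEquiv]

theorem hasSum_pi_prod {s : ℕ} {f : Fin s → ℤ → ℂ} {a : Fin s → ℂ}
    (hf : ∀ i, Summable fun m => ‖f i m‖) (ha : ∀ i, HasSum (f i) (a i)) :
    (Summable fun h : Fin s → ℤ => ‖∏ i, f i (h i)‖) ∧
      HasSum (fun h : Fin s → ℤ => ∏ i, f i (h i)) (∏ i, a i) := by
  induction s with
  | zero =>
    refine ⟨(hasSum_unique _).summable, ?_⟩
    simp
  | succ s ih =>
    obtain ⟨h1, h2⟩ := ih (fun i => hf i.succ) (fun i => ha i.succ)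
    have key : ∀ p : ℤ × (Fin s → ℤ), (∏ i, f i (Fin.consEquiv (fun _ : Fin (s + 1) => ℤ) p i)) =
        f 0 p.1 * ∏ i : Fin s, f i.succ (p.2 i) := fun p => by
      simp [Fin.prod_univ_succ, Fin.consEquiv]
    have hs := summable_mul_of_summable_norm (hf 0) h1
    have hs' := (hf 0).mul_norm h1
    constructor
    · rw [← (Fin.consEquiv fun _ : Fin (s + 1) => ℤ).summable_iff]
      simpa only [Function.comp_def, key] using hs'
    · rw [← (Fin.consEquiv fun _ : Fin (s + 1) => ℤ).hasSum_iff, Fin.prod_univ_succ]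
      simpa only [Function.comp_def, key] using (ha 0).mul h2 hs

/-- The support of a frequency vector, as a finite set. -/
abbrev suppF {s : ℕ} (h : Fin s → ℤ) : Finset (Fin s) := {j | h j ≠ 0}

theorem support_split {R : Type*} [CommSemiring R] {s : ℕ} (G : Finset (Fin s) → R)
    (ψ : Fin s → ℤ → R) (h : Fin s → ℤ) :
    G (suppF h) * ∏ i, ψ i (h i) =
      ∑ u, G u * ∏ i, (if h i ≠ 0 ↔ i ∈ u then ψ i (h i) else 0) := by
  rw [Finset.sum_eq_single (suppF h)]
  · congr 1
    exact Finset.prod_congr rfl fun i _ => by simp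
  · intro u _ hu
    obtain ⟨i, hi⟩ : ∃ i, ¬ (h i ≠ 0 ↔ i ∈ u) := by
      by_contra! hc
      exact hu (by ext i; simp [hc i])
    rw [Finset.prod_eq_zero (Finset.mem_univ i) (if_neg hi), mul_zero]
  · simp

theorem tsum_supportFn_mul_prod {s : ℕ} (G : Finset (Fin s) → ℝ≥0∞) (ψ : Fin s → ℤ → ℝ≥0∞) :
    ∑' h : Fin s → ℤ, G (suppF h) * ∏ i, ψ i (h i) =
      ∑ u, G u * ∏ i, (if i ∈ u then ∑' m, (if m = 0 then 0 else ψ i m) else ψ i 0) := by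
  simp_rw [support_split]
  rw [Summable.tsum_finsetSum fun _ _ => ENNReal.summable]
  refine Finset.sum_congr rfl fun u _ => ?_
  rw [ENNReal.tsum_mul_left,
    tsum_pi_prod_ennreal fun i m => if m ≠ 0 ↔ i ∈ u then ψ i m else 0]
  congr 1
  refine Finset.prod_congr rfl fun i _ => ?_
  by_cases hi : i ∈ u
  · simp only [hi, iff_true, if_true]
    exact tsum_congr fun m => by by_cases hm : m = 0 <;> simp [hm]
  · simp only [hi, iff_false, if_false, not_not]
    rw [tsum_eq_single 0 fun m hm => by simp [hm]]
    simp

/-- The univariate decay `|m|^{-x}`, with the value `1` at `m = 0`. -/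
noncomputable def decay (x : ℝ) (m : ℤ) : ℝ := if m = 0 then 1 else |(m : ℝ)| ^ (-x)

theorem decay_pos (x : ℝ) (m : ℤ) : 0 < decay x m := by
  unfold decay
  split_ifs with hm
  · exact one_pos
  · exact Real.rpow_pos_of_pos (abs_pos.mpr (Int.cast_ne_zero.mpr hm)) _

theorem decay_zero (x : ℝ) : decay x 0 = 1 := by simp [decay]

theorem decay_neg (x : ℝ) (m : ℤ) : decay x (-m) = decay x m := by simp [decay]

theorem decay_rpow (x lam : ℝ) (m : ℤ) : decay x m ^ lam = decay (x * lam) m := by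
  unfold decay
  split_ifs with hm
  · simp
  · rw [← Real.rpow_mul (abs_nonneg _), neg_mul]

theorem r_inv (α : ℝ) (γ : Finset ℕ → ℝ) {s : ℕ} (h : Fin s → ℤ) :
    (r α γ h)⁻¹ = γ (coordSet (suppF h)) * ∏ i, decay α (h i) := by
  unfold r
  rw [mul_inv, inv_inv, ← Finset.prod_inv_distrib, Finset.prod_filter]
  congr 1
  refine Finset.prod_congr rfl fun i _ => ?_
  by_cases hi : h i = 0
  · simp [hi, decay]
  · simp [hi, decay, Real.rpow_neg]

theorem r_pos (α : ℝ) {γ : Finset ℕ → ℝ} (hγ : ∀ u, 0 < γ u) {s : ℕ} (h : Fin s → ℤ) :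
    0 < r α γ h := by
  rw [← inv_pos, r_inv]
  exact mul_pos (hγ _) (Finset.prod_pos fun i _ => decay_pos _ _)

theorem r_inv_rpow (α lam : ℝ) {γ : Finset ℕ → ℝ} (hγ : ∀ u, 0 < γ u) {s : ℕ} (h : Fin s → ℤ) :
    ((r α γ h)⁻¹) ^ lam = γ (coordSet (suppF h)) ^ lam * ∏ i, decay (α * lam) (h i) := by
  rw [r_inv, Real.mul_rpow (hγ _).le (Finset.prod_nonneg fun i _ => (decay_pos _ _).le),
    ← Real.finsetProd_rpow _ _ fun i _ => (decay_pos _ _).le]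
  simp_rw [decay_rpow]

theorem summable_decay {x : ℝ} (hx : 1 < x) : Summable (decay x) := by
  have h1 : Summable fun m : ℤ => |(m : ℝ)| ^ (-x) := Real.summable_abs_int_rpow hx
  refine h1.congr_cofinite ?_
  rw [Filter.EventuallyEq, Filter.eventually_cofinite]
  refine (Set.finite_singleton (0 : ℤ)).subset fun m hm => ?_
  by_contra h0
  exact hm (by simp [decay, show m ≠ 0 from h0])

theorem zeta_nonneg (x : ℝ) : 0 ≤ zeta x :=
  tsum_nonneg fun k => Real.rpow_nonneg (by positivity) _

theorem summable_zeta {x : ℝ} (hx : 1 < x) : Summable fun k : ℕ => ((k : ℝ) + 1) ^ (-x) := by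
  have := (summable_nat_add_iff 1).mpr (Real.summable_nat_rpow.mpr (show -x < -1 by linarith))
  simpa using this

/-- `∑_{m ≠ 0} |m|^{-x} = 2 ζ(x)`. -/
theorem tsum_decay {x : ℝ} (hx : 1 < x) :
    ∑' m : ℤ, (if m = 0 then 0 else ENNReal.ofReal (decay x m)) = ENNReal.ofReal (2 * zeta x) := by
  have hz : ENNReal.ofReal (zeta x) = ∑' k : ℕ, ENNReal.ofReal (((k : ℝ) + 1) ^ (-x)) :=
    ENNReal.ofReal_tsum_of_nonneg (fun k => Real.rpow_nonneg (by positivity) _) (summable_zeta hx)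
  have hd : ∀ k : ℕ, decay x (k + 1 : ℤ) = ((k : ℝ) + 1) ^ (-x) := fun k => by
    rw [decay, if_neg (by omega)]
    push_cast
    rw [abs_of_nonneg (by positivity)]
  rw [tsum_of_add_one_of_neg_add_one ENNReal.summable ENNReal.summable, two_mul,
    ENNReal.ofReal_add (zeta_nonneg x) (zeta_nonneg x), hz]
  simp only [if_true, add_zero]
  congr 1
  · exact tsum_congr fun k => by rw [if_neg (by omega), hd]
  · exact tsum_congr fun k => by rw [if_neg (by omega), decay_neg, hd]

/-- The average over the candidates `c ∈ {1, …, n-1}` of the indicator of `n ∣ c k + const`,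
bounded above, for `k ≠ 0`. -/
noncomputable def congrBound (n : ℕ) (k : ℤ) : ℝ≥0∞ :=
  if k = 0 then 0 else (if (n : ℤ) ∣ k then 1 else 0) + ((n - 1 : ℕ) : ℝ≥0∞)⁻¹

theorem congrBound_neg (n : ℕ) (k : ℤ) : congrBound n (-k) = congrBound n k := by
  simp [congrBound]

theorem inv_pred_le {n : ℕ} (hn : 2 ≤ n) : ((n - 1 : ℕ) : ℝ≥0∞)⁻¹ ≤ 2 * (n : ℝ≥0∞)⁻¹ := by
  have h : (n : ℝ≥0∞) ≤ 2 * ((n - 1 : ℕ) : ℝ≥0∞) := by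
    exact_mod_cast (by omega : n ≤ 2 * (n - 1))
  rw [← ENNReal.inv_le_inv, inv_inv, ENNReal.mul_inv (by simp) (by simp), inv_inv] 
  rw [mul_comm, ← div_eq_mul_inv]
  exact ENNReal.div_le_of_le_mul' h

/-- The decay restricted to the nonzero multiples of `n`. -/
noncomputable def multDecay (x : ℝ) (n : ℕ) (p : ℤ) : ℝ≥0∞ :=
  if p = 0 then 0 else if (n : ℤ) ∣ p then ENNReal.ofReal (decay x p) else 0

theorem multDecay_neg (x : ℝ) (n : ℕ) (p : ℤ) : multDecay x n (-p) = multDecay x n p := by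
  simp [multDecay, decay_neg]

theorem tsum_multDecay_le {x : ℝ} (hx : 1 < x) {n : ℕ} (hn : 1 ≤ n) :
    ∑' p : ℤ, multDecay x n p ≤ ENNReal.ofReal (2 * zeta x) * (n : ℝ≥0∞)⁻¹ := by
  have hn0 : (n : ℤ) ≠ 0 := by omega
  have hinj : Function.Injective fun m : ℤ => (n : ℤ) * m := fun a b h => mul_left_cancel₀ hn0 h
  have hsupp : Function.support (multDecay x n) ⊆ Set.range fun m : ℤ => (n : ℤ) * m := by
    intro p hp
    simp only [Function.mem_support, multDecay, ne_eq, ite_eq_left_iff, not_forall,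
      ite_eq_right_iff] at hp
    obtain ⟨-, ⟨m, hm⟩, -⟩ := hp
    exact ⟨m, hm.symm⟩
  rw [← hinj.tsum_eq hsupp, ← tsum_decay hx, ← ENNReal.tsum_mul_right]
  refine ENNReal.tsum_le_tsum fun m => ?_
  by_cases hm : m = 0
  · simp [multDecay, hm]
  have hnm : (n : ℤ) * m ≠ 0 := mul_ne_zero hn0 hm
  have hn1 : (1 : ℝ) ≤ n := by exact_mod_cast hn
  have hcast : (n : ℝ≥0∞)⁻¹ = ENNReal.ofReal ((n : ℝ)⁻¹) := by
    rw [ENNReal.ofReal_inv_of_pos (by linarith), ENNReal.ofReal_natCast]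
  simp only [multDecay, hnm, hm, if_false, dvd_mul_right, if_true]
  rw [hcast, ← ENNReal.ofReal_mul (decay_pos _ _).le]
  refine ENNReal.ofReal_le_ofReal ?_
  simp only [decay, hnm, hm, if_false]
  push_cast
  rw [abs_mul, Real.mul_rpow (abs_nonneg _) (abs_nonneg _), mul_comm]
  refine mul_le_mul_of_nonneg_left ?_ (Real.rpow_nonneg (abs_nonneg _) _)
  rw [abs_of_nonneg (by linarith), ← Real.rpow_neg_one]
  exact Real.rpow_le_rpow_of_exponent_le hn1 (by linarith)

theorem decay_mul_decay_le {x : ℝ} (hx : 0 ≤ x) {k m : ℤ} (hk : k ≠ 0) (hm : m ≠ 0)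
    (hkm : m - k ≠ 0) :
    decay x k * decay x m ≤ 2 ^ x * (decay x (m - k) * decay x k + decay x (m - k) * decay x m) := by
  have key : ∀ p : ℤ, p ≠ 0 → |((m - k : ℤ) : ℝ)| ≤ 2 * |(p : ℝ)| →
      decay x p ≤ 2 ^ x * decay x (m - k) := by
    intro p hp hle
    have hp' : 0 < |(p : ℝ)| := abs_pos.mpr (by exact_mod_cast hp)
    have hd' : 0 < |((m - k : ℤ) : ℝ)| := abs_pos.mpr (by exact_mod_cast hkm)
    simp only [decay, hp, hkm, if_false]
    rw [Real.rpow_neg hp'.le, Real.rpow_neg hd'.le, ← div_eq_mul_inv,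
      le_div_iff₀ (Real.rpow_pos_of_pos hd' _), inv_mul_le_iff₀ (Real.rpow_pos_of_pos hp' _),
      ← Real.mul_rpow hp'.le zero_le_two]
    exact Real.rpow_le_rpow hd'.le (by linarith) hx
  have hmk : |((m - k : ℤ) : ℝ)| ≤ |(m : ℝ)| + |(k : ℝ)| := by push_cast; exact abs_sub _ _
  have hdk := decay_pos x k
  have hdm := decay_pos x m
  have hdd := decay_pos x (m - k)
  have h2 : (0 : ℝ) < 2 ^ x := Real.rpow_pos_of_pos two_pos _
  rcases le_total |(m : ℝ)| |(k : ℝ)| with h | h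
  · have h1 := mul_le_mul_of_nonneg_right (key k hk (by linarith)) hdm.le
    have h3 : 0 ≤ 2 ^ x * (decay x (m - k) * decay x k) := by positivity
    linarith
  · have h1 := mul_le_mul_of_nonneg_left (key m hm (by linarith)) hdk.le
    have h3 : 0 ≤ 2 ^ x * (decay x (m - k) * decay x m) := by positivity
    linarith

/-- Sum over nonzero frequencies. -/
noncomputable def nzSum (x : ℝ) (β : ℤ → ℝ≥0∞) : ℝ≥0∞ :=
  ∑' m : ℤ, if m = 0 then 0 else ENNReal.ofReal (decay x m) * β m

theorem nzSum_mono (x : ℝ) {β β' : ℤ → ℝ≥0∞} (h : ∀ m, m ≠ 0 → β m ≤ β' m) :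
    nzSum x β ≤ nzSum x β' := by
  refine ENNReal.tsum_le_tsum fun m => ?_
  split_ifs with hm
  · exact le_rfl
  · exact mul_le_mul_right (h m hm) _

theorem nzSum_const {x : ℝ} (hx : 1 < x) (c : ℝ≥0∞) :
    nzSum x (fun _ => c) = ENNReal.ofReal (2 * zeta x) * c := by
  rw [← tsum_decay hx, ← ENNReal.tsum_mul_right]
  exact tsum_congr fun m => by split_ifs <;> simp

theorem nzSum_add (x : ℝ) (β β' : ℤ → ℝ≥0∞) :
    nzSum x (fun m => β m + β' m) = nzSum x β + nzSum x β' := by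
  unfold nzSum
  rw [← ENNReal.tsum_add]
  exact tsum_congr fun m => by split_ifs <;> simp [mul_add]

theorem nzSum_congrBound_le {x : ℝ} (hx : 1 < x) {n : ℕ} (hn : 2 ≤ n) :
    nzSum x (congrBound n) ≤ ENNReal.ofReal (2 * zeta x) * (3 * (n : ℝ≥0∞)⁻¹) := by
  calc nzSum x (congrBound n)
      ≤ nzSum x (fun m => (if (n : ℤ) ∣ m then 1 else 0) + 2 * (n : ℝ≥0∞)⁻¹) :=
        nzSum_mono x fun m hm => by
          simp only [congrBound, hm, if_false]
          gcongr
          exact inv_pred_le hn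
    _ = ∑' p, multDecay x n p + ENNReal.ofReal (2 * zeta x) * (2 * (n : ℝ≥0∞)⁻¹) := by
        rw [nzSum_add, nzSum_const hx]
        congr 1
        exact tsum_congr fun m => by unfold multDecay; split_ifs <;> simp_all
    _ ≤ _ := by
        refine (add_le_add_left (tsum_multDecay_le hx (by omega)) _).trans_eq ?_
        ring

theorem nzSum_nzSum_dvd_le {x : ℝ} (hx : 1 < x) {n : ℕ} (hn : 1 ≤ n) :
    nzSum x (fun k => nzSum x fun m =>
      if m - k = 0 then 0 else if (n : ℤ) ∣ m - k then 1 else 0) ≤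
      ENNReal.ofReal (2 * zeta x) ^ 2 * (ENNReal.ofReal (2 ^ (x + 1)) * (n : ℝ≥0∞)⁻¹) := by
  set Z := ENNReal.ofReal (2 * zeta x) with hZ
  let D : ℤ → ℝ≥0∞ := fun m => if m = 0 then 0 else ENNReal.ofReal (decay x m)
  have hD : ∑' m, D m = Z := tsum_decay hx
  have step : nzSum x (fun k => nzSum x fun m =>
      if m - k = 0 then 0 else if (n : ℤ) ∣ m - k then 1 else 0) ≤
      ∑' k, ∑' m, ENNReal.ofReal (2 ^ x) *
        (D k * multDecay x n (m - k) + D m * multDecay x n (m - k)) := by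
    refine ENNReal.tsum_le_tsum fun k => ?_
    split_ifs with hk
    · exact zero_le
    beta_reduce
    rw [nzSum, ← ENNReal.tsum_mul_left]
    refine ENNReal.tsum_le_tsum fun m => ?_
    by_cases hm : m = 0
    · simp [hm]
    by_cases hmk : m - k = 0
    · simp [hmk]
    by_cases hd : (n : ℤ) ∣ m - k
    · simp only [hm, hmk, hd, hk, D, multDecay, if_true, if_false, mul_one]
      have h1 := (decay_pos x k).le
      have h2 := (decay_pos x m).le
      have h3 := (decay_pos x (m - k)).le
      rw [← ENNReal.ofReal_mul h1, ← ENNReal.ofReal_mul h1, ← ENNReal.ofReal_mul h2,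
        ← ENNReal.ofReal_add (by positivity) (by positivity), ← ENNReal.ofReal_mul (by positivity)]
      refine ENNReal.ofReal_le_ofReal ?_
      have := decay_mul_decay_le (by linarith : 0 ≤ x) hk hm hmk
      linarith
    · simp [hmk, hd]
  have hM := tsum_multDecay_le hx hn
  have e1 : ∑' k, ∑' m, D k * multDecay x n (m - k) = Z * ∑' p, multDecay x n p := by
    rw [← hD, ← ENNReal.tsum_mul_right]
    refine tsum_congr fun k => ?_
    rw [ENNReal.tsum_mul_left, ← (Equiv.subRight k).tsum_eq (multDecay x n)]
    rfl
  have e2 : ∑' k, ∑' m, D m * multDecay x n (m - k) = Z * ∑' p, multDecay x n p := by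
    rw [ENNReal.tsum_comm, ← e1]
    refine tsum_congr fun k => tsum_congr fun m => ?_
    rw [← neg_sub, multDecay_neg]
  refine step.trans ?_
  simp_rw [ENNReal.tsum_mul_left, ENNReal.tsum_add]
  rw [e1, e2, Real.rpow_add two_pos, Real.rpow_one, ENNReal.ofReal_mul (by positivity),
    ENNReal.ofReal_ofNat]
  calc ENNReal.ofReal (2 ^ x) * (Z * ∑' p, multDecay x n p + Z * ∑' p, multDecay x n p)
      ≤ ENNReal.ofReal (2 ^ x) * (Z * (Z * (n : ℝ≥0∞)⁻¹) + Z * (Z * (n : ℝ≥0∞)⁻¹)) := by gcongr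
    _ = _ := by ring

theorem nzSum_nzSum_congrBound_le {x : ℝ} (hx : 1 < x) {n : ℕ} (hn : 2 ≤ n) :
    nzSum x (fun k => nzSum x fun m => congrBound n (m - k)) ≤
      ENNReal.ofReal (2 * zeta x) ^ 2 * (ENNReal.ofReal (2 + 2 ^ (x + 1)) * (n : ℝ≥0∞)⁻¹) := by
  have hb : ∀ k : ℤ, congrBound n k ≤
      (if k = 0 then 0 else if (n : ℤ) ∣ k then 1 else 0) + 2 * (n : ℝ≥0∞)⁻¹ := fun k => by
    unfold congrBound
    split_ifs
    · exact zero_le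
    · gcongr; exact inv_pred_le hn
    · gcongr; exact inv_pred_le hn
  refine (nzSum_mono x fun k _ => nzSum_mono x fun m _ => hb (m - k)).trans ?_
  simp_rw [nzSum_add, nzSum_const hx]
  refine (add_le_add_left (nzSum_nzSum_dvd_le hx (by omega)) _).trans_eq ?_
  rw [ENNReal.ofReal_add zero_le_two (by positivity), ENNReal.ofReal_ofNat]
  ring

theorem rpow_sum_le {ι : Type*} (t : Finset ι) (f : ι → ℝ≥0∞) {p : ℝ} (hp : 0 < p) (hp1 : p ≤ 1) :
    (∑ i ∈ t, f i) ^ p ≤ ∑ i ∈ t, f i ^ p := by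
  classical
  induction t using Finset.induction_on with
  | empty => simp [hp]
  | insert i t hi ih =>
    rw [Finset.sum_insert hi, Finset.sum_insert hi]
    exact (ENNReal.rpow_add_le_add_rpow _ _ hp.le hp1).trans (add_le_add_right ih _)

theorem rpow_tsum_le {ι : Type*} (f : ι → ℝ≥0∞) {p : ℝ} (hp : 0 < p) (hp1 : p ≤ 1) :
    (∑' i, f i) ^ p ≤ ∑' i, f i ^ p := by
  rw [ENNReal.tsum_eq_iSup_sum]
  have := (ENNReal.orderIsoRpow p hp).map_iSup fun t : Finset ι => ∑ i ∈ t, f i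
  simp only [ENNReal.orderIsoRpow_apply] at this
  rw [this]
  exact iSup_le fun t => (rpow_sum_le t f hp hp1).trans (ENNReal.sum_le_tsum t)

theorem tsum_subtype_pred {ι : Type*} (p : ι → Prop) (f : ι → ℝ≥0∞) :
    ∑' i : {i // p i}, f i = ∑' i, {i | p i}.indicator f i :=
  tsum_subtype {i | p i} f

/-- The summand `r(h)^{-λ}` in `[0, ∞]`. -/
noncomputable def invR (α : ℝ) (γ : Finset ℕ → ℝ) (lam : ℝ) {s : ℕ} (h : Fin s → ℤ) : ℝ≥0∞ :=
  ENNReal.ofReal ((r α γ h)⁻¹) ^ lam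

theorem invR_eq (α : ℝ) {γ : Finset ℕ → ℝ} (hγ : ∀ u, 0 < γ u) {lam : ℝ} (hl : 0 < lam) {s : ℕ}
    (h : Fin s → ℤ) :
    invR α γ lam h = ENNReal.ofReal (γ (coordSet (suppF h)) ^ lam) *
      ∏ i, ENNReal.ofReal (decay (α * lam) (h i)) := by
  rw [invR, ENNReal.ofReal_rpow_of_nonneg (inv_nonneg.mpr (r_pos α hγ h).le) hl.le,
    r_inv_rpow α lam hγ, ENNReal.ofReal_mul (Real.rpow_nonneg (hγ _).le _),
    ENNReal.ofReal_prod_of_nonneg fun i _ => (decay_pos _ _).le]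

theorem tsum_invR_mul {α : ℝ} {γ : Finset ℕ → ℝ} (hγ : ∀ u, 0 < γ u) {lam : ℝ} (hl : 0 < lam)
    (hx : 1 < α * lam) {s : ℕ} (j : Fin s) (β : ℤ → ℝ≥0∞) :
    ∑' h : Fin s → ℤ, invR α γ lam h * β (h j) =
      ∑ u, ENNReal.ofReal (γ (coordSet u) ^ lam) *
        (ENNReal.ofReal (2 * zeta (α * lam)) ^ (u.erase j).card *
          if j ∈ u then nzSum (α * lam) β else β 0) := by
  have e : ∀ h : Fin s → ℤ, invR α γ lam h * β (h j) =
      ENNReal.ofReal (γ (coordSet (suppF h)) ^ lam) *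
        ∏ i, (ENNReal.ofReal (decay (α * lam) (h i)) * if i = j then β (h i) else 1) := fun h => by
    rw [invR_eq α hγ hl, Finset.prod_mul_distrib, mul_assoc]
    congr 2
    simp
  simp_rw [e]
  rw [tsum_supportFn_mul_prod (fun u => ENNReal.ofReal (γ (coordSet u) ^ lam))
    fun i m => ENNReal.ofReal (decay (α * lam) m) * if i = j then β m else 1]
  refine Finset.sum_congr rfl fun u _ => ?_
  congr 1
  rw [← Finset.mul_prod_erase _ _ (Finset.mem_univ j), mul_comm]
  congr 1
  · rw [Finset.prod_congr (g := fun i => if i ∈ u then ENNReal.ofReal (2 * zeta (α * lam)) else 1)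
      rfl fun i hi => ?_]
    · rw [← Finset.prod_filter, Finset.prod_const]
      congr 2
      ext i
      simp
    · have hij : i ≠ j := Finset.ne_of_mem_erase hi
      simp only [hij, if_false, mul_one, decay_zero, ENNReal.ofReal_one, tsum_decay hx]
  · simp [nzSum, decay_zero]

/-- The constant of the pair `(u, v)` of supports in the bound for the `j`-th step. -/
noncomputable def pairConst (x : ℝ) {s : ℕ} (j : Fin s) (u v : Finset (Fin s)) : ℝ≥0∞ :=
  if j ∈ u then if j ∈ v then ENNReal.ofReal (2 + 2 ^ (x + 1)) else 3 else if j ∈ v then 3 else 0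

theorem tsum_invR_mul_invR_mul_congrBound_le {α : ℝ} {γ : Finset ℕ → ℝ} (hγ : ∀ u, 0 < γ u)
    {lam : ℝ} (hl : 0 < lam) (hx : 1 < α * lam) {s n : ℕ} (hn : 2 ≤ n) (j : Fin s) :
    ∑' (h : Fin s → ℤ) (q : Fin s → ℤ),
        invR α γ lam h * (invR α γ lam q * congrBound n (q j - h j)) ≤
      ∑ u : Finset (Fin s), ∑ v : Finset (Fin s),
        (ENNReal.ofReal (γ (coordSet u) ^ lam) * ENNReal.ofReal (2 * zeta (α * lam)) ^ u.card) *
        (ENNReal.ofReal (γ (coordSet v) ^ lam) * ENNReal.ofReal (2 * zeta (α * lam)) ^ v.card) *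
        (pairConst (α * lam) j u v * (n : ℝ≥0∞)⁻¹) := by
  set x := α * lam with hxdef
  set Z := ENNReal.ofReal (2 * zeta x) with hZ
  have e : ∀ h : Fin s → ℤ,
      ∑' q : Fin s → ℤ, invR α γ lam h * (invR α γ lam q * congrBound n (q j - h j)) =
      ∑ v : Finset (Fin s), ENNReal.ofReal (γ (coordSet v) ^ lam) * Z ^ (v.erase j).card *
        (invR α γ lam h * if j ∈ v then nzSum x fun m => congrBound n (m - h j)
          else congrBound n (h j)) := fun h => by
    rw [ENNReal.tsum_mul_left, tsum_invR_mul hγ hl hx j fun m => congrBound n (m - h j),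
      Finset.mul_sum]
    refine Finset.sum_congr rfl fun v _ => ?_
    simp only [zero_sub, congrBound_neg]
    ring
  simp_rw [e]
  rw [Summable.tsum_finsetSum fun _ _ => ENNReal.summable, Finset.sum_comm]
  refine Finset.sum_le_sum fun v _ => ?_
  rw [ENNReal.tsum_mul_left, tsum_invR_mul hγ hl hx j fun k =>
    if j ∈ v then nzSum x fun m => congrBound n (m - k) else congrBound n k, Finset.mul_sum]
  refine Finset.sum_le_sum fun u _ => ?_
  have hcard : ∀ t : Finset (Fin s), j ∈ t → Z ^ t.card = Z ^ (t.erase j).card * Z :=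
    fun t ht => by rw [← pow_succ, Finset.card_erase_add_one ht]
  have h1 := nzSum_congrBound_le hx hn
  have h2 := nzSum_nzSum_congrBound_le hx hn
  have hb0 : congrBound n 0 = 0 := by simp [congrBound]
  unfold pairConst
  set A := ENNReal.ofReal (γ (coordSet u) ^ lam)
  set B := ENNReal.ofReal (γ (coordSet v) ^ lam)
  by_cases hu : j ∈ u <;> by_cases hv : j ∈ v <;> simp only [hu, hv, if_true, if_false]
  · rw [hcard u hu, hcard v hv]
    calc _ ≤ B * Z ^ (v.erase j).card * (A * (Z ^ (u.erase j).card *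
          (Z ^ 2 * (ENNReal.ofReal (2 + 2 ^ (x + 1)) * (n : ℝ≥0∞)⁻¹)))) := by gcongr
      _ = _ := by ring
  · rw [hcard u hu, Finset.erase_eq_of_notMem hv]
    calc _ ≤ B * Z ^ v.card * (A * (Z ^ (u.erase j).card * (Z * (3 * (n : ℝ≥0∞)⁻¹)))) := by gcongr
      _ = _ := by ring
  · rw [hcard v hv, Finset.erase_eq_of_notMem hu]
    simp only [sub_zero]
    calc _ ≤ B * Z ^ (v.erase j).card * (A * (Z ^ u.card * (Z * (3 * (n : ℝ≥0∞)⁻¹)))) := by gcongr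
      _ = _ := by ring
  · simp [hb0]

theorem sum_pairConst_le {x : ℝ} (hx : 1 ≤ x) {s : ℕ} (u v : Finset (Fin s)) :
    ∑ j, pairConst x j u v ≤ ENNReal.ofReal (max 6 (5 / 2 + 2 ^ (2 * x + 1))) *
      ((max u.card 1 : ℕ) * (max v.card 1 : ℕ)) := by
  set τ : ℝ := max 6 (5 / 2 + 2 ^ (2 * x + 1))
  have hτ6 : (6 : ℝ) ≤ τ := le_max_left _ _
  have hτ2 : 2 + 2 ^ (x + 1) ≤ τ := by
    refine le_trans ?_ (le_max_right _ _)
    have : (2 : ℝ) ^ (x + 1) ≤ 2 ^ (2 * x + 1) :=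
      Real.rpow_le_rpow_of_exponent_le one_le_two (by linarith)
    linarith
  have h3τ : (3 : ℝ≥0∞) * 2 ≤ ENNReal.ofReal τ := by
    rw [show (3 : ℝ≥0∞) * 2 = ENNReal.ofReal 6 by norm_num]
    exact ENNReal.ofReal_le_ofReal hτ6
  have hcard : (u ∪ v).card ≤ u.card + v.card := Finset.card_union_le u v
  rcases (u ∩ v).eq_empty_or_nonempty with hd | ⟨i, hi⟩
  · have hb : ∀ j ∈ Finset.univ, pairConst x j u v ≤ if j ∈ u ∪ v then 3 else 0 := fun j _ => by
      have : ¬ (j ∈ u ∧ j ∈ v) := fun h => by simpa [hd] using Finset.mem_inter.mpr h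
      unfold pairConst
      by_cases hu : j ∈ u <;> by_cases hv : j ∈ v <;> simp_all
    refine (Finset.sum_le_sum hb).trans ?_
    rw [← Finset.sum_filter, Finset.sum_const, nsmul_eq_mul, Finset.filter_mem_eq_inter,
      Finset.univ_inter]
    have hN : (u ∪ v).card ≤ 2 * (max u.card 1 * max v.card 1) := by
      have h1 : max u.card 1 ≤ max u.card 1 * max v.card 1 := Nat.le_mul_of_pos_right _ (by simp)
      have h2 : max v.card 1 ≤ max u.card 1 * max v.card 1 := Nat.le_mul_of_pos_left _ (by simp)
      have h3 := le_max_left u.card 1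
      have h4 := le_max_left v.card 1
      omega
    calc ((u ∪ v).card : ℝ≥0∞) * 3
        ≤ (2 * (max u.card 1 * max v.card 1) : ℕ) * 3 := by gcongr
      _ = 3 * 2 * ((max u.card 1 : ℕ) * (max v.card 1 : ℕ)) := by push_cast; ring
      _ ≤ _ := by gcongr
  · have hb : ∀ j ∈ Finset.univ, pairConst x j u v ≤
        if j ∈ u ∪ v then ENNReal.ofReal τ else 0 := fun j _ => by
      have h3 : (3 : ℝ≥0∞) ≤ ENNReal.ofReal τ := le_trans (by norm_num) h3τ
      have h2 := ENNReal.ofReal_le_ofReal hτ2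
      unfold pairConst
      by_cases hu : j ∈ u <;> by_cases hv : j ∈ v <;> simp [hu, hv, h2, h3]
    refine (Finset.sum_le_sum hb).trans ?_
    rw [← Finset.sum_filter, Finset.sum_const, nsmul_eq_mul, Finset.filter_mem_eq_inter,
      Finset.univ_inter, mul_comm]
    gcongr
    have hci : 1 ≤ (u ∩ v).card := Finset.card_pos.mpr ⟨i, hi⟩
    have hcu : 1 ≤ u.card := hci.trans (Finset.card_le_card Finset.inter_subset_left)
    have hcv : 1 ≤ v.card := hci.trans (Finset.card_le_card Finset.inter_subset_right)
    have hun := Finset.card_union_add_card_inter u v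
    rw [max_eq_left hcu, max_eq_left hcv]
    have : (u ∪ v).card ≤ u.card * v.card := by nlinarith
    exact_mod_cast this

theorem card_candidates_le {n : ℕ} (hn : n.Prime) {s : ℕ} (z : Fin s → ℕ) (j : Fin s)
    (l : Fin s → ℤ) (hl : l j ≠ 0) :
    ∑ c ∈ Finset.Icc 1 (n - 1),
        (if (n : ℤ) ∣ ∑ i, l i * (Function.update z j c i : ℤ) then (1 : ℝ≥0∞) else 0) ≤
      ((n - 1 : ℕ) : ℝ≥0∞) * congrBound n (l j) := by
  have hn1 : ((n - 1 : ℕ) : ℝ≥0∞) ≠ 0 := by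
    have := hn.two_le
    exact_mod_cast (by omega : n - 1 ≠ 0)
  rw [congrBound, if_neg hl, mul_add, ENNReal.mul_inv_cancel hn1 (ENNReal.natCast_ne_top _),
    ← Finset.sum_filter, Finset.sum_const, nsmul_one]
  by_cases hd : (n : ℤ) ∣ l j
  · rw [if_pos hd, mul_one]
    refine le_add_right ?_
    have := Finset.card_filter_le (Finset.Icc 1 (n - 1))
      fun c => (n : ℤ) ∣ ∑ i, l i * (Function.update z j c i : ℤ)
    rw [Nat.card_Icc] at this
    exact_mod_cast (by omega : _ ≤ n - 1)
  · rw [if_neg hd, mul_zero, zero_add]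
    have : (Finset.filter (fun c => (n : ℤ) ∣ ∑ i, l i * (Function.update z j c i : ℤ))
        (Finset.Icc 1 (n - 1))).card ≤ 1 := by
      rw [Finset.card_le_one]
      intro a ha b hb
      simp only [Finset.mem_filter, Finset.mem_Icc] at ha hb
      have hs : ∀ c : ℕ, ∑ i, l i * (Function.update z j c i : ℤ) =
          l j * c + ∑ i ∈ Finset.univ.erase j, l i * (z i : ℤ) := fun c => by
        rw [← Finset.add_sum_erase _ _ (Finset.mem_univ j), Function.update_self]
        congr 1
        exact Finset.sum_congr rfl fun i hi => by
          rw [Function.update_of_ne (Finset.ne_of_mem_erase hi)]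
      have h := dvd_sub ha.2 hb.2
      rw [hs, hs, add_sub_add_right_eq_sub, ← mul_sub] at h
      have h' := ((Nat.prime_iff_prime_int.mp hn).dvd_or_dvd h).resolve_left hd
      have h0 := Int.eq_zero_of_abs_lt_dvd h' (by rw [abs_lt]; omega)
      omega
    exact_mod_cast this

theorem partialCriterion_rpow_le {α : ℝ} {γ : Finset ℕ → ℝ} (hγ : ∀ u, 0 < γ u) {lam : ℝ}
    (hl : 0 < lam) (hl1 : lam ≤ 1) {s n : ℕ} (z : Fin s → ℕ) (j : Fin s) :
    partialCriterion α γ n z j ^ lam ≤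
      ∑' (h : Fin s → ℤ) (l : Fin s → ℤ), invR α γ lam h * invR α γ lam (h + l) *
        (if l j ≠ 0 then if (n : ℤ) ∣ ∑ i, l i * (z i : ℤ) then 1 else 0 else 0) := by
  classical
  refine (rpow_tsum_le _ hl hl1).trans (ENNReal.tsum_le_tsum fun h => ?_)
  refine (rpow_tsum_le _ hl hl1).trans ?_
  rw [tsum_subtype_pred
      (fun l : Fin s → ℤ => IsDual n z l ∧ l j ≠ 0 ∧ ∀ i, j < i → l i = 0)
    fun l => ENNReal.ofReal ((r α γ h)⁻¹ * (r α γ (h + l))⁻¹) ^ lam]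
  refine ENNReal.tsum_le_tsum fun l => Set.indicator_apply_le' (fun hmem => ?_) fun _ => zero_le
  obtain ⟨⟨-, hd⟩, hj, -⟩ := hmem
  rw [if_pos hj, if_pos hd, mul_one, ENNReal.ofReal_mul (inv_nonneg.mpr (r_pos α hγ h).le),
    ENNReal.mul_rpow_of_nonneg _ _ hl.le]
  rfl

theorem IsCBC.partialCriterion_rpow_le {α : ℝ} {γ : Finset ℕ → ℝ} (hγ : ∀ u, 0 < γ u) {lam : ℝ}
    (hl : 0 < lam) (hl1 : lam ≤ 1) {s n : ℕ} (hn : n.Prime) {z : Fin s → ℕ}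
    (hz : IsCBC α γ n z) (j : Fin s) :
    partialCriterion α γ n z j ^ lam ≤ ∑' (h : Fin s → ℤ) (q : Fin s → ℤ),
        invR α γ lam h * (invR α γ lam q * congrBound n (q j - h j)) := by
  have hn1 : ((n - 1 : ℕ) : ℝ≥0∞) ≠ 0 := by
    have := hn.two_le
    exact_mod_cast (by omega : n - 1 ≠ 0)
  rw [← ENNReal.mul_le_mul_iff_right hn1 (ENNReal.natCast_ne_top _)]
  calc ((n - 1 : ℕ) : ℝ≥0∞) * partialCriterion α γ n z j ^ lam
      = ∑ c ∈ Finset.Icc 1 (n - 1), partialCriterion α γ n z j ^ lam := by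
        rw [Finset.sum_const, Nat.card_Icc, nsmul_eq_mul, Nat.add_sub_cancel]
    _ ≤ ∑ c ∈ Finset.Icc 1 (n - 1), ∑' (h : Fin s → ℤ) (l : Fin s → ℤ),
          invR α γ lam h * invR α γ lam (h + l) * (if l j ≠ 0 then
            if (n : ℤ) ∣ ∑ i, l i * (Function.update z j c i : ℤ) then 1 else 0 else 0) :=
        Finset.sum_le_sum fun c hc => (ENNReal.rpow_le_rpow ((hz j).2 c hc) hl.le).trans
          (LatticeKernel.partialCriterion_rpow_le hγ hl hl1 _ j)
    _ ≤ ∑' (h : Fin s → ℤ) (l : Fin s → ℤ), ((n - 1 : ℕ) : ℝ≥0∞) *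
          (invR α γ lam h * (invR α γ lam (h + l) * congrBound n (l j))) := by
        rw [← Summable.tsum_finsetSum fun _ _ => ENNReal.summable]
        refine ENNReal.tsum_le_tsum fun h => ?_
        rw [← Summable.tsum_finsetSum fun _ _ => ENNReal.summable]
        refine ENNReal.tsum_le_tsum fun l => ?_
        rw [← Finset.mul_sum]
        by_cases hlj : l j = 0
        · simp [hlj]
        simp only [ne_eq, hlj, not_false_eq_true, if_true]
        calc _ ≤ invR α γ lam h * invR α γ lam (h + l) *
              (((n - 1 : ℕ) : ℝ≥0∞) * congrBound n (l j)) := by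
              gcongr
              exact card_candidates_le hn z j l hlj
          _ = _ := by ring
    _ = _ := by
        simp_rw [ENNReal.tsum_mul_left]
        congr 1
        refine tsum_congr fun h => ?_
        rw [← (Equiv.subRight h).tsum_eq]
        congr 1
        exact tsum_congr fun q => by simp

theorem searchCriterion_le_sum {α : ℝ} {γ : Finset ℕ → ℝ} {s n : ℕ} (z : Fin s → ℕ) :
    searchCriterion α γ n z ≤ ∑ j, partialCriterion α γ n z j := by
  classical
  unfold searchCriterion partialCriterion
  rw [← Summable.tsum_finsetSum fun _ _ => ENNReal.summable]
  refine ENNReal.tsum_le_tsum fun h => ?_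
  simp_rw [fun j => tsum_subtype_pred
      (fun l : Fin s → ℤ => IsDual n z l ∧ l j ≠ 0 ∧ ∀ i, j < i → l i = 0)
    fun l => ENNReal.ofReal ((r α γ h)⁻¹ * (r α γ (h + l))⁻¹)]
  rw [tsum_subtype_pred (fun l : Fin s → ℤ => IsDual n z l)
    fun l => ENNReal.ofReal ((r α γ h)⁻¹ * (r α γ (h + l))⁻¹),
    ← Summable.tsum_finsetSum fun _ _ => ENNReal.summable]
  refine ENNReal.tsum_le_tsum fun l => Set.indicator_apply_le' (fun hmem => ?_) fun _ => zero_le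
  have hne : (suppF l).Nonempty := by
    obtain ⟨i, hi⟩ := Function.ne_iff.mp hmem.1
    exact ⟨i, by simpa using hi⟩
  have hmax := Finset.max'_mem _ hne
  refine le_trans (le_of_eq ?_)
    (Finset.single_le_sum (fun _ _ => zero_le) (Finset.mem_univ ((suppF l).max' hne)))
  rw [Set.indicator_of_mem]
  refine ⟨hmem, by simpa using hmax, fun i hi => ?_⟩
  by_contra h0
  exact absurd (Finset.le_max' (suppF l) i (by simpa using h0)) (not_le.mpr hi)

theorem IsCBC.searchCriterion_rpow_le {α : ℝ} {γ : Finset ℕ → ℝ} (hγ : ∀ u, 0 < γ u) {lam : ℝ}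
    (hl : 0 < lam) (hl1 : lam ≤ 1) (hx : 1 < α * lam) {s n : ℕ} (hn : n.Prime) {z : Fin s → ℕ}
    (hz : IsCBC α γ n z) :
    searchCriterion α γ n z ^ lam ≤
      ENNReal.ofReal (max 6 (5 / 2 + 2 ^ (2 * α * lam + 1))) * (n : ℝ≥0∞)⁻¹ *
        (∑ u ∈ (Finset.range s).powerset, ENNReal.ofReal (weightTerm α γ lam u)) ^ 2 := by
  set x := α * lam with hxdef
  have hw : ∑ u ∈ (Finset.range s).powerset, ENNReal.ofReal (weightTerm α γ lam u) =
      ∑ u : Finset (Fin s), ((max u.card 1 : ℕ) : ℝ≥0∞) *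
        (ENNReal.ofReal (γ (coordSet u) ^ lam) * ENNReal.ofReal (2 * zeta x) ^ u.card) := by
    symm
    refine Finset.sum_bij (fun u _ => coordSet u) (fun u _ => ?_) (fun u _ v _ h => ?_)
      (fun t ht => ?_) (fun u _ => ?_)
    · refine Finset.mem_powerset.mpr fun k hk => ?_
      simp only [coordSet, Finset.mem_map] at hk
      obtain ⟨i, -, rfl⟩ := hk
      exact Finset.mem_range.mpr i.isLt
    · exact Finset.map_injective _ h
    · refine ⟨Finset.univ.filter fun i : Fin s => (i : ℕ) ∈ t, Finset.mem_univ _, ?_⟩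
      ext k
      simp only [coordSet, Finset.mem_map, Finset.mem_filter, Finset.mem_univ, true_and,
        Fin.valEmbedding_apply]
      constructor
      · rintro ⟨i, hi, rfl⟩
        exact hi
      · exact fun hk => ⟨⟨k, Finset.mem_range.mp (Finset.mem_powerset.mp ht hk)⟩, hk, rfl⟩
    · have hγl := Real.rpow_nonneg (hγ (coordSet u)).le lam
      rw [weightTerm, ENNReal.ofReal_mul (mul_nonneg (Nat.cast_nonneg _) hγl),
        ENNReal.ofReal_mul (Nat.cast_nonneg _),
        ENNReal.ofReal_natCast, ENNReal.ofReal_pow (mul_nonneg zero_le_two (zeta_nonneg _)),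
        coordSet, Finset.card_map, mul_assoc]
  rw [hw, mul_assoc 2 α lam, ← hxdef]
  calc searchCriterion α γ n z ^ lam
      ≤ (∑ j, partialCriterion α γ n z j) ^ lam :=
        ENNReal.rpow_le_rpow (searchCriterion_le_sum z) hl.le
    _ ≤ ∑ j, partialCriterion α γ n z j ^ lam := rpow_sum_le _ _ hl hl1
    _ ≤ ∑ j : Fin s, ∑ u : Finset (Fin s), ∑ v : Finset (Fin s),
        (ENNReal.ofReal (γ (coordSet u) ^ lam) * ENNReal.ofReal (2 * zeta x) ^ u.card) *
        (ENNReal.ofReal (γ (coordSet v) ^ lam) * ENNReal.ofReal (2 * zeta x) ^ v.card) *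
        (pairConst x j u v * (n : ℝ≥0∞)⁻¹) :=
        Finset.sum_le_sum fun j _ => (hz.partialCriterion_rpow_le hγ hl hl1 hn j).trans
          (tsum_invR_mul_invR_mul_congrBound_le hγ hl hx hn.two_le j)
    _ = ∑ u : Finset (Fin s), ∑ v : Finset (Fin s),
        (ENNReal.ofReal (γ (coordSet u) ^ lam) * ENNReal.ofReal (2 * zeta x) ^ u.card) *
        (ENNReal.ofReal (γ (coordSet v) ^ lam) * ENNReal.ofReal (2 * zeta x) ^ v.card) *
        ((∑ j, pairConst x j u v) * (n : ℝ≥0∞)⁻¹) := by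
        rw [Finset.sum_comm]
        refine Finset.sum_congr rfl fun u _ => ?_
        rw [Finset.sum_comm]
        refine Finset.sum_congr rfl fun v _ => ?_
        rw [← Finset.mul_sum, Finset.sum_mul]
    _ ≤ ∑ u : Finset (Fin s), ∑ v : Finset (Fin s),
        (ENNReal.ofReal (γ (coordSet u) ^ lam) * ENNReal.ofReal (2 * zeta x) ^ u.card) *
        (ENNReal.ofReal (γ (coordSet v) ^ lam) * ENNReal.ofReal (2 * zeta x) ^ v.card) *
        ((ENNReal.ofReal (max 6 (5 / 2 + 2 ^ (2 * x + 1))) *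
          ((max u.card 1 : ℕ) * (max v.card 1 : ℕ))) * (n : ℝ≥0∞)⁻¹) := by
        gcongr
        exact sum_pairConst_le hx.le _ _
    _ = _ := by
        rw [sq, Finset.sum_mul_sum, Finset.mul_sum]
        refine Finset.sum_congr rfl fun u _ => ?_
        rw [Finset.mul_sum]
        exact Finset.sum_congr rfl fun v _ => by ring

theorem norm_fourier_apply (m : ℤ) (x : UnitAddCircle) : ‖fourier m x‖ = 1 := by
  rw [fourier_apply, Circle.norm_coe]

theorem hasSum_eta {α : ℝ} (hα : 1 < α) (x : UnitAddCircle) :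
    HasSum (fun m : ℤ => if m = 0 then 0 else (decay α m : ℂ) * fourier m x) (eta α x : ℂ) := by
  set F : ℤ → ℂ := fun m => if m = 0 then 0 else (decay α m : ℂ) * fourier m x with hF
  have hs : Summable F := by
    refine Summable.of_norm_bounded (summable_decay hα) fun m => ?_
    by_cases hm : m = 0
    · simp [hF, hm, decay]
    · simp only [hF, hm, if_false]
      rw [norm_mul, norm_fourier_apply, mul_one, Complex.norm_real, Real.norm_eq_abs,
        abs_of_pos (decay_pos α m)]
  have hconj : conj (∑' m, F m) = ∑' m, F m := by
    rw [Complex.conj_tsum, ← (Equiv.neg ℤ).tsum_eq F]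
    refine tsum_congr fun m => ?_
    by_cases hm : m = 0
    · simp [hF, hm]
    · simp [hF, hm, decay_neg]
  have hre : (∑' m, F m).re = eta α x := by
    rw [Complex.re_tsum hs, eta]
    symm
    have hsupp : Function.support (fun m => (F m).re) ⊆ {m : ℤ | m ≠ 0} := fun m hm h0 => by
      simp [hF, h0] at hm
    rw [← tsum_subtype_eq_of_support_subset hsupp]
    refine tsum_congr fun ⟨m, hm⟩ => ?_
    have hm' : m ≠ 0 := hm
    simp only [hF, hm', if_false, Complex.re_ofReal_mul, decay]
    rw [Real.rpow_neg (abs_nonneg _), div_eq_inv_mul]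
  have := hs.hasSum
  rwa [← (Complex.conj_eq_iff_re.mp hconj), hre] at this

theorem mFourier_sub_apply {s : ℕ} (h : Fin s → ℤ) (y t : UnitAddTorus (Fin s)) :
    UnitAddTorus.mFourier h (fun j => y j - t j) =
      UnitAddTorus.mFourier h y * conj (UnitAddTorus.mFourier h t) := by
  simp only [UnitAddTorus.mFourier, ContinuousMap.coe_mk, map_prod, ← Finset.prod_mul_distrib]
  refine Finset.prod_congr rfl fun i _ => ?_
  rw [← fourier_neg, fourier_apply, fourier_apply, fourier_apply, smul_sub, sub_eq_add_neg,
    AddCircle.toCircle_add, Circle.coe_mul, neg_smul]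

theorem eta_neg (α : ℝ) (x : UnitAddCircle) : eta α (-x) = eta α x := by
  refine tsum_congr fun m => ?_
  congr 1
  rw [fourier_apply, fourier_apply, smul_neg, AddCircle.toCircle_neg, Circle.coe_inv_eq_conj,
    Complex.conj_re]

theorem kernel_comm (α : ℝ) (γ : Finset ℕ → ℝ) {s : ℕ} (y y' : UnitAddTorus (Fin s)) :
    kernel α γ y y' = kernel α γ y' y := by
  refine Finset.sum_congr rfl fun u _ => ?_
  congr 1
  exact Finset.prod_congr rfl fun j _ => by rw [← eta_neg, neg_sub]

theorem norm_mFourier_apply {s : ℕ} (h : Fin s → ℤ) (y : UnitAddTorus (Fin s)) :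
    ‖UnitAddTorus.mFourier h y‖ = 1 := by
  simp only [UnitAddTorus.mFourier, ContinuousMap.coe_mk, norm_prod, norm_fourier_apply,
    Finset.prod_const_one]

/-- The Fourier expansion of the reproducing kernel. -/
theorem summable_and_hasSum_kernel {α : ℝ} (hα : 1 < α) {γ : Finset ℕ → ℝ} {s : ℕ}
    (w : UnitAddTorus (Fin s)) :
    (Summable fun h : Fin s → ℤ => ‖(((r α γ h)⁻¹ : ℝ) : ℂ) * UnitAddTorus.mFourier h w‖) ∧
      HasSum (fun h : Fin s → ℤ => (((r α γ h)⁻¹ : ℝ) : ℂ) * UnitAddTorus.mFourier h w)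
        ((∑ u : Finset (Fin s), γ (coordSet u) * ∏ j ∈ u, eta α (w j) : ℝ) : ℂ) := by
  let F : Finset (Fin s) → Fin s → ℤ → ℂ := fun u i m =>
    if m ≠ 0 ↔ i ∈ u then (decay α m : ℂ) * fourier m (w i) else 0
  have hF : ∀ u i, Summable fun m => ‖F u i m‖ := fun u i => by
    refine Summable.of_nonneg_of_le (fun _ => norm_nonneg _) (fun m => ?_) (summable_decay hα)
    simp only [F]
    split_ifs
    · rw [norm_mul, norm_fourier_apply, mul_one, Complex.norm_real, Real.norm_eq_abs,
        abs_of_pos (decay_pos _ _)]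
    · simpa using (decay_pos α m).le
  have hS : ∀ u i, HasSum (F u i) (if i ∈ u then (eta α (w i) : ℂ) else 1) := fun u i => by
    by_cases hi : i ∈ u
    · rw [if_pos hi]
      convert! hasSum_eta hα (w i) using 2 with m
      by_cases hm : m = 0 <;> simp [F, hi, hm]
    · rw [if_neg hi]
      convert! hasSum_ite_eq (0 : ℤ) (1 : ℂ) using 2 with m
      by_cases hm : m = 0 <;> simp [F, hi, hm, decay]
  have hsplit : ∀ h : Fin s → ℤ, (((r α γ h)⁻¹ : ℝ) : ℂ) * UnitAddTorus.mFourier h w =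
      ∑ u, (γ (coordSet u) : ℂ) * ∏ i, F u i (h i) := fun h => by
    rw [← support_split (fun u => (γ (coordSet u) : ℂ)) fun i m => (decay α m : ℂ) * fourier m (w i),
      r_inv, Finset.prod_mul_distrib]
    simp only [UnitAddTorus.mFourier, ContinuousMap.coe_mk]
    push_cast
    ring
  have hsum := fun u => hasSum_pi_prod (hF u) (hS u)
  simp_rw [hsplit]
  constructor
  · refine Summable.of_nonneg_of_le (fun _ => norm_nonneg _) (fun h => norm_sum_le _ _)
      (summable_sum fun u _ => ?_)
    simp_rw [norm_mul]
    exact (hsum u).1.mul_left _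
  · convert! hasSum_sum fun u (_ : u ∈ Finset.univ) => (hsum u).2.mul_left (γ (coordSet u) : ℂ)
      using 1
    push_cast
    refine Finset.sum_congr rfl fun u _ => ?_
    congr 1
    simp

theorem summable_r_inv {α : ℝ} (hα : 1 < α) {γ : Finset ℕ → ℝ} (hγ : ∀ u, 0 < γ u) {s : ℕ} :
    Summable fun h : Fin s → ℤ => (r α γ h)⁻¹ := by
  refine (summable_and_hasSum_kernel hα (γ := γ) (0 : UnitAddTorus (Fin s))).1.congr fun h => ?_
  rw [norm_mul, norm_mFourier_apply, mul_one, Complex.norm_real, Real.norm_eq_abs,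
    abs_of_pos (inv_pos.mpr (r_pos α hγ h))]

theorem hasSum_kernel {α : ℝ} (hα : 1 < α) (γ : Finset ℕ → ℝ) {s : ℕ}
    (y t : UnitAddTorus (Fin s)) :
    HasSum (fun h : Fin s → ℤ => (((r α γ h)⁻¹ : ℝ) : ℂ) *
      conj (UnitAddTorus.mFourier h t) * UnitAddTorus.mFourier h y) (kernel α γ t y : ℂ) := by
  rw [kernel_comm]
  refine (summable_and_hasSum_kernel hα (γ := γ) fun j => y j - t j).2.congr_fun fun h => ?_
  rw [mFourier_sub_apply]
  ring

theorem exists_continuousMap_hasSum {s : ℕ} {b : (Fin s → ℤ) → ℂ} (hb : Summable fun h => ‖b h‖)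
    {G : UnitAddTorus (Fin s) → ℂ}
    (hG : ∀ y, HasSum (fun h => b h * UnitAddTorus.mFourier h y) (G y)) :
    ∃ F : C(UnitAddTorus (Fin s), ℂ), ⇑F = G ∧ HasSum (fun h => b h • UnitAddTorus.mFourier h) F := by
  have hs : Summable fun h => b h • UnitAddTorus.mFourier h := by
    refine Summable.of_norm ?_
    simpa only [norm_smul, UnitAddTorus.mFourier_norm, mul_one] using hb
  refine ⟨_, ?_, hs.hasSum⟩
  ext y
  exact (ContinuousMap.hasSum_apply hs.hasSum y).unique (hG y)

theorem pi_haarAddCircle_eq_volume {s : ℕ} :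
    Measure.pi (fun _ : Fin s => (AddCircle.haarAddCircle : Measure UnitAddCircle)) =
      (volume : Measure (UnitAddTorus (Fin s))) := by
  have h : (AddCircle.haarAddCircle : Measure UnitAddCircle) = volume := by
    rw [AddCircle.volume_eq_smul_haarAddCircle]
    simp
  rw [h]
  rfl

/-- The coefficients of an absolutely convergent Fourier series are its Fourier coefficients. -/
theorem mFourierCoeff_eq_of_hasSum {s : ℕ} {b : (Fin s → ℤ) → ℂ} (hb : Summable fun h => ‖b h‖)
    {G : UnitAddTorus (Fin s) → ℂ}
    (hG : ∀ y, HasSum (fun h => b h * UnitAddTorus.mFourier h y) (G y)) (h : Fin s → ℤ) :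
    UnitAddTorus.mFourierCoeff G h = b h := by
  classical
  obtain ⟨F, rfl, hF⟩ := exists_continuousMap_hasSum hb hG
  let : MeasureSpace UnitAddCircle := ⟨AddCircle.haarAddCircle⟩
  have : IsProbabilityMeasure (volume : Measure UnitAddCircle) :=
    inferInstanceAs (IsProbabilityMeasure AddCircle.haarAddCircle)
  have h1 := (ContinuousMap.toLp (E := ℂ) 2 (volume : Measure (UnitAddTorus (Fin s))) ℂ).hasSum hF
  simp only [map_smul] at h1
  have h2 := UnitAddTorus.mFourierBasis_repr
    (ContinuousMap.toLp (E := ℂ) 2 (volume : Measure (UnitAddTorus (Fin s))) ℂ F) h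
  rw [UnitAddTorus.mFourierCoeff_toLp, HilbertBasis.repr_apply_apply,
    UnitAddTorus.coe_mFourierBasis] at h2
  rw [← h2]
  have h3 := (innerSL ℂ (UnitAddTorus.mFourierLp 2 h)).hasSum h1
  simp only [innerSL_apply_apply, inner_smul_right] at h3
  refine h3.unique ?_
  have h4 := orthonormal_iff_ite.mp (UnitAddTorus.orthonormal_mFourier (d := Fin s)) h
  convert! hasSum_ite_eq h (b h) using 2 with m
  have h5 := h4 m
  simp only [UnitAddTorus.mFourierLp] at h5 ⊢
  rw [h5]
  by_cases hm : h = m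
  · subst hm; simp
  · simp [hm, Ne.symm hm]

/-- Parseval's identity for an absolutely convergent Fourier series. -/
theorem eLpNorm_sq_eq_tsum {s : ℕ} {b : (Fin s → ℤ) → ℂ} (hb : Summable fun h => ‖b h‖)
    {g : UnitAddTorus (Fin s) → ℝ}
    (hG : ∀ y, HasSum (fun h => b h * UnitAddTorus.mFourier h y) (g y : ℂ)) :
    eLpNorm g 2 volume ^ 2 = ∑' h, ‖b h‖ₑ ^ 2 := by
  have hcoeff := mFourierCoeff_eq_of_hasSum hb hG
  obtain ⟨F, hFg, hF⟩ := exists_continuousMap_hasSum hb hG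
  rw [← pi_haarAddCircle_eq_volume]
  let : MeasureSpace UnitAddCircle := ⟨AddCircle.haarAddCircle⟩
  have : IsProbabilityMeasure (volume : Measure UnitAddCircle) :=
    inferInstanceAs (IsProbabilityMeasure AddCircle.haarAddCircle)
  change eLpNorm g 2 (volume : Measure (UnitAddTorus (Fin s))) ^ 2 = _
  set Φ := ContinuousMap.toLp (E := ℂ) 2 (volume : Measure (UnitAddTorus (Fin s))) ℂ F with hΦ
  have h1 : ∀ h, UnitAddTorus.mFourierBasis.repr Φ h = b h := fun h => by
    rw [UnitAddTorus.mFourierBasis_repr, hΦ, UnitAddTorus.mFourierCoeff_toLp, hFg, hcoeff]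
  have h2 : eLpNorm g 2 (volume : Measure (UnitAddTorus (Fin s))) =
      eLpNorm F 2 (volume : Measure (UnitAddTorus (Fin s))) := by
    refine eLpNorm_congr_enorm_ae (Filter.Eventually.of_forall fun y => ?_)
    rw [hFg]
    simp [← ofReal_norm]
  have h3 : eLpNorm Φ 2 (volume : Measure (UnitAddTorus (Fin s))) =
      eLpNorm F 2 (volume : Measure (UnitAddTorus (Fin s))) :=
    eLpNorm_congr_ae (ContinuousMap.coeFn_toLp _ F)
  have hsq : Summable fun h => ‖b h‖ ^ 2 := by
    have := (lp.memℓp (UnitAddTorus.mFourierBasis.repr Φ)).summable (by norm_num)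
    simpa [h1] using this
  have h4 : ‖Φ‖ ^ 2 = ∑' h, ‖b h‖ ^ 2 := by
    have := lp.norm_rpow_eq_tsum (p := 2) (by norm_num) (UnitAddTorus.mFourierBasis.repr Φ)
    simpa [h1] using this
  rw [h2, ← h3, ← Lp.enorm_def, ← ofReal_norm, ← ENNReal.ofReal_pow (norm_nonneg _), h4,
    ENNReal.ofReal_tsum_of_nonneg (fun _ => sq_nonneg _) hsq]
  exact tsum_congr fun h => by rw [ENNReal.ofReal_pow (norm_nonneg _), ofReal_norm]

/-! ### Characters at the lattice points -/

theorem mFourier_latticePoint {s n : ℕ} [NeZero n] (z : Fin s → ℕ) (h : Fin s → ℤ) (k : Fin n) :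
    UnitAddTorus.mFourier h (latticePoint n z k) =
      ZMod.stdAddChar ((((k : ℕ) + 1 : ℕ) : ZMod n) * ((∑ j, h j * (z j : ℤ) : ℤ) : ZMod n)) := by
  have hcast : (((k : ℕ) + 1 : ℕ) : ZMod n) * ((∑ j, h j * (z j : ℤ) : ℤ) : ZMod n) =
      ((((k : ℕ) + 1 : ℕ) * ∑ j, h j * (z j : ℤ) : ℤ) : ZMod n) := by push_cast; rfl
  rw [hcast, ZMod.stdAddChar_coe]
  simp only [UnitAddTorus.mFourier, ContinuousMap.coe_mk, latticePoint, fourier_coe_apply]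
  rw [← Complex.exp_sum]
  congr 1
  push_cast
  rw [Finset.mul_sum, Finset.mul_sum, Finset.sum_div]
  exact Finset.sum_congr rfl fun j _ => by ring

theorem sum_fin_succ_eq_sum_zmod {n : ℕ} [NeZero n] (F : ZMod n → ℂ) :
    ∑ k : Fin n, F (((k : ℕ) + 1 : ℕ) : ZMod n) = ∑ a : ZMod n, F a := by
  have e : Function.Bijective fun k : Fin n => (((k : ℕ) + 1 : ℕ) : ZMod n) := by
    rw [Fintype.bijective_iff_injective_and_card]
    refine ⟨fun a b hab => ?_, by simp [ZMod.card]⟩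
    have : ((a : ℕ) : ZMod n) = ((b : ℕ) : ZMod n) := by
      simpa using hab
    rw [ZMod.natCast_eq_natCast_iff'] at this
    rw [Nat.mod_eq_of_lt a.isLt, Nat.mod_eq_of_lt b.isLt] at this
    exact Fin.ext this
  exact Fintype.sum_bijective _ e _ _ fun _ => rfl

theorem sum_mFourier_latticePoint {s n : ℕ} [NeZero n] (z : Fin s → ℕ) (h : Fin s → ℤ) :
    ∑ k, UnitAddTorus.mFourier h (latticePoint n z k) =
      if (n : ℤ) ∣ ∑ j, h j * (z j : ℤ) then (n : ℂ) else 0 := by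
  classical
  simp_rw [mFourier_latticePoint]
  rw [sum_fin_succ_eq_sum_zmod fun a => ZMod.stdAddChar (a * ((∑ j, h j * (z j : ℤ) : ℤ) : ZMod n)),
    AddChar.sum_mulShift _ (ZMod.isPrimitive_stdAddChar n), ZMod.card]
  simp only [ZMod.intCast_zmod_eq_zero_iff_dvd]
  split_ifs <;> simp

/-! ### The interpolation problem -/

/-- The Fourier coefficients of `∑_k a_k K(t_k, ·)`. -/
noncomputable def interpCoeff (α : ℝ) (γ : Finset ℕ → ℝ) {s : ℕ} (n : ℕ) (z : Fin s → ℕ)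
    (a : Fin n → ℝ) (h : Fin s → ℤ) : ℂ :=
  (((r α γ h)⁻¹ : ℝ) : ℂ) * ∑ k, (a k : ℂ) * conj (UnitAddTorus.mFourier h (latticePoint n z k))

theorem hasSum_interpCoeff {α : ℝ} (hα : 1 < α) (γ : Finset ℕ → ℝ) {s : ℕ} (n : ℕ) (z : Fin s → ℕ)
    (a : Fin n → ℝ) (y : UnitAddTorus (Fin s)) :
    HasSum (fun h => interpCoeff α γ n z a h * UnitAddTorus.mFourier h y)
      ((∑ k, a k * kernel α γ (latticePoint n z k) y : ℝ) : ℂ) := by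
  push_cast
  refine (hasSum_sum fun k (_ : k ∈ Finset.univ) =>
    (hasSum_kernel hα γ y (latticePoint n z k)).mul_left (a k : ℂ)).congr_fun fun h => ?_
  rw [interpCoeff, Finset.mul_sum, Finset.sum_mul]
  exact Finset.sum_congr rfl fun k _ => by ring

theorem norm_sum_mul_conj_mFourier_le {s n : ℕ} (z : Fin s → ℕ) (a : Fin n → ℝ) (h : Fin s → ℤ) :
    ‖∑ k, (a k : ℂ) * conj (UnitAddTorus.mFourier h (latticePoint n z k))‖ ≤ ∑ k, |a k| := by
  refine (norm_sum_le _ _).trans_eq (Finset.sum_congr rfl fun k _ => ?_)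
  rw [norm_mul, RCLike.norm_conj, norm_mFourier_apply, mul_one, Complex.norm_real, Real.norm_eq_abs]

theorem summable_interpCoeff {α : ℝ} (hα : 1 < α) {γ : Finset ℕ → ℝ} (hγ : ∀ u, 0 < γ u) {s : ℕ}
    (n : ℕ) (z : Fin s → ℕ) (a : Fin n → ℝ) :
    Summable fun h => ‖interpCoeff α γ n z a h‖ := by
  refine Summable.of_nonneg_of_le (fun _ => norm_nonneg _) (fun h => ?_)
    ((summable_r_inv hα hγ).mul_right (∑ k, |a k|))
  rw [interpCoeff, norm_mul, Complex.norm_real, Real.norm_eq_abs,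
    abs_of_pos (inv_pos.mpr (r_pos α hγ h))]
  exact mul_le_mul_of_nonneg_left (norm_sum_mul_conj_mFourier_le z a h)
    (inv_pos.mpr (r_pos α hγ h)).le

theorem eq_zero_of_sum_mFourier_eq_zero {s n : ℕ} (hs : 1 ≤ s) (hn : n.Prime) {z : Fin s → ℕ}
    (hz : ∀ j, z j ∈ Finset.Icc 1 (n - 1)) {a : Fin n → ℝ}
    (ha : ∀ h : Fin s → ℤ,
      ∑ k, (a k : ℂ) * conj (UnitAddTorus.mFourier h (latticePoint n z k)) = 0) : a = 0 := by
  classical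
  have : NeZero n := ⟨hn.ne_zero⟩
  have : Fact n.Prime := ⟨hn⟩
  let j0 : Fin s := ⟨0, hs⟩
  have hz0 : (z j0 : ZMod n) ≠ 0 := by
    have := Finset.mem_Icc.mp (hz j0)
    rw [Ne, ZMod.natCast_eq_zero_iff]
    exact fun hd => by have := Nat.le_of_dvd (by omega) hd; omega
  have hfreq : ∀ (m : ZMod n) (k : Fin n),
      UnitAddTorus.mFourier (Pi.single j0 (m.val : ℤ)) (latticePoint n z k) =
        ZMod.stdAddChar (m * ((z j0 : ZMod n) * (((k : ℕ) + 1 : ℕ) : ZMod n))) := fun m k => by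
    rw [mFourier_latticePoint, Finset.sum_eq_single j0]
    · congr 1
      rw [Pi.single_eq_same]
      push_cast
      rw [ZMod.natCast_zmod_val]
      ring
    · intro j _ hj
      simp [hj]
    · simp
  ext p
  have h1 : ∑ m : ZMod n, ZMod.stdAddChar (m * ((z j0 : ZMod n) * (((p : ℕ) + 1 : ℕ) : ZMod n))) *
      ∑ k, (a k : ℂ) *
        conj (UnitAddTorus.mFourier (Pi.single j0 (m.val : ℤ)) (latticePoint n z k)) = 0 :=
    Finset.sum_eq_zero fun m _ => by rw [ha, mul_zero]
  simp_rw [Finset.mul_sum] at h1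
  rw [Finset.sum_comm] at h1
  have h2 : ∀ k : Fin n, ∑ m : ZMod n,
      ZMod.stdAddChar (m * ((z j0 : ZMod n) * (((p : ℕ) + 1 : ℕ) : ZMod n))) * ((a k : ℂ) *
        conj (UnitAddTorus.mFourier (Pi.single j0 (m.val : ℤ)) (latticePoint n z k))) =
      if k = p then (a p : ℂ) * n else 0 := fun k => by
    have e : ∀ m : ZMod n, ZMod.stdAddChar (m * ((z j0 : ZMod n) * (((p : ℕ) + 1 : ℕ) : ZMod n))) *
        ((a k : ℂ) * conj (UnitAddTorus.mFourier (Pi.single j0 (m.val : ℤ)) (latticePoint n z k))) =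
        (a k : ℂ) * ZMod.stdAddChar (m * ((z j0 : ZMod n) * ((p : ℕ) - (k : ℕ) : ZMod n))) := fun m => by
      rw [hfreq, ← AddChar.map_neg_eq_conj, mul_left_comm, ← AddChar.map_add_eq_mul]
      congr 2
      push_cast
      ring
    simp_rw [e]
    rw [← Finset.mul_sum, AddChar.sum_mulShift _ (ZMod.isPrimitive_stdAddChar n), ZMod.card]
    by_cases hkp : k = p
    · subst hkp; simp
    · have : (z j0 : ZMod n) * ((p : ℕ) - (k : ℕ) : ZMod n) ≠ 0 := by
        refine mul_ne_zero hz0 (sub_ne_zero.mpr fun h => hkp ?_)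
        rw [ZMod.natCast_eq_natCast_iff', Nat.mod_eq_of_lt p.isLt, Nat.mod_eq_of_lt k.isLt] at h
        exact Fin.ext h.symm
      simp [hkp, this]
  simp_rw [h2] at h1
  simpa [hn.ne_zero] using h1

theorem det_kernelMatrix_ne_zero {α : ℝ} (hα : 1 < α) {γ : Finset ℕ → ℝ} (hγ : ∀ u, 0 < γ u)
    {s n : ℕ} (hs : 1 ≤ s) (hn : n.Prime) {z : Fin s → ℕ}
    (hz : ∀ j, z j ∈ Finset.Icc 1 (n - 1)) : (kernelMatrix α γ n z).det ≠ 0 := by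
  intro hdet
  obtain ⟨a, ha0, ha⟩ := Matrix.exists_mulVec_eq_zero_iff.mpr hdet
  refine ha0 (eq_zero_of_sum_mFourier_eq_zero hs hn hz fun h => ?_)
  have hg : ∀ k', ∑ k, a k * kernel α γ (latticePoint n z k) (latticePoint n z k') = 0 :=
    fun k' => by
      refine Eq.trans ?_ (congrFun ha k')
      rw [Matrix.mulVec, dotProduct]
      exact Finset.sum_congr rfl fun k _ => by
        rw [kernelMatrix, Matrix.of_apply, kernel_comm, mul_comm]
  have hq : HasSum (fun h : Fin s → ℤ => (r α γ h)⁻¹ *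
      ‖∑ k, (a k : ℂ) * conj (UnitAddTorus.mFourier h (latticePoint n z k))‖ ^ 2) 0 := by
    have h1 := hasSum_sum fun k' (_ : k' ∈ Finset.univ) =>
      (hasSum_interpCoeff hα γ n z a (latticePoint n z k')).mul_left (a k' : ℂ)
    simp only [hg, Complex.ofReal_zero, mul_zero, Finset.sum_const_zero] at h1
    rw [← Complex.hasSum_ofReal, Complex.ofReal_zero]
    refine h1.congr_fun fun h => ?_
    push_cast
    rw [← Complex.mul_conj', map_sum]
    simp only [interpCoeff, map_mul, Complex.conj_ofReal, Complex.conj_conj]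
    rw [Complex.ofReal_inv, ← mul_assoc, Finset.mul_sum]
    exact Finset.sum_congr rfl fun k' _ => by ring
  have hpos : ∀ h : Fin s → ℤ, 0 ≤ (r α γ h)⁻¹ *
      ‖∑ k, (a k : ℂ) * conj (UnitAddTorus.mFourier h (latticePoint n z k))‖ ^ 2 := fun h =>
    mul_nonneg (inv_pos.mpr (r_pos α hγ h)).le (sq_nonneg _)
  have h0 := congrFun ((hasSum_zero_iff_of_nonneg hpos).mp hq) h
  simpa [(r_pos α hγ h).ne'] using h0

theorem kernelInterpolant_apply_latticePoint {α : ℝ} (hα : 1 < α) {γ : Finset ℕ → ℝ}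
    (hγ : ∀ u, 0 < γ u) {s n : ℕ} (hs : 1 ≤ s) (hn : n.Prime) {z : Fin s → ℕ}
    (hz : ∀ j, z j ∈ Finset.Icc 1 (n - 1)) (f : UnitAddTorus (Fin s) → ℝ) (k : Fin n) :
    kernelInterpolant α γ n z f (latticePoint n z k) = f (latticePoint n z k) := by
  have hdet : IsUnit (kernelMatrix α γ n z).det :=
    (det_kernelMatrix_ne_zero hα hγ hs hn hz).isUnit
  set v : Fin n → ℝ := fun k' => f (latticePoint n z k')
  have h1 : (kernelMatrix α γ n z).mulVec ((kernelMatrix α γ n z)⁻¹.mulVec v) = v := by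
    rw [Matrix.mulVec_mulVec, Matrix.mul_nonsing_inv _ hdet, Matrix.one_mulVec]
  have h2 := congrFun h1 k
  rw [Matrix.mulVec, dotProduct] at h2
  rw [kernelInterpolant]
  refine Eq.trans (Finset.sum_congr rfl fun k' _ => ?_) h2
  rw [kernelMatrix, Matrix.of_apply, kernel_comm, mul_comm]

theorem isKernelInterpolant_iff {α : ℝ} (hα : 1 < α) {γ : Finset ℕ → ℝ} (hγ : ∀ u, 0 < γ u)
    {s n : ℕ} (hs : 1 ≤ s) (hn : n.Prime) {z : Fin s → ℕ}
    (hz : ∀ j, z j ∈ Finset.Icc 1 (n - 1)) (f g : UnitAddTorus (Fin s) → ℝ) :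
    IsKernelInterpolant α γ n z f g ↔ g = kernelInterpolant α γ n z f := by
  constructor
  · rintro ⟨⟨a, ha⟩, hg⟩
    have hdet : IsUnit (kernelMatrix α γ n z).det :=
      (det_kernelMatrix_ne_zero hα hγ hs hn hz).isUnit
    have h1 : (kernelMatrix α γ n z).mulVec a = fun k' => f (latticePoint n z k') := by
      ext k'
      rw [← hg, ha, Matrix.mulVec, dotProduct]
      exact Finset.sum_congr rfl fun k _ => by
        rw [kernelMatrix, Matrix.of_apply, kernel_comm, mul_comm]
    funext y
    rw [ha, kernelInterpolant, ← h1, Matrix.mulVec_mulVec, Matrix.nonsing_inv_mul _ hdet,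
      Matrix.one_mulVec]
  · rintro rfl
    exact ⟨⟨_, fun _ => rfl⟩, kernelInterpolant_apply_latticePoint hα hγ hs hn hz f⟩

/-! ### The error of functions that vanish at the lattice points -/

theorem sq_tsum_mul_le {ι : Type*} (f g : ι → ℝ≥0∞) :
    (∑' i, f i * g i) ^ 2 ≤ (∑' i, f i ^ 2) * ∑' i, g i ^ 2 := by
  let : MeasurableSpace ι := ⊤
  have h := ENNReal.lintegral_mul_le_Lp_mul_Lq (Measure.count : Measure ι)
    Real.HolderConjugate.two_two (f := f) (g := g) measurable_from_top.aemeasurable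
    measurable_from_top.aemeasurable
  simp only [lintegral_count' measurable_from_top, Pi.mul_apply, ENNReal.rpow_two] at h
  calc _ ≤ _ := pow_le_pow_left' h 2
    _ = _ := by
      rw [mul_pow, ← ENNReal.rpow_two, ← ENNReal.rpow_two, ← ENNReal.rpow_mul, ← ENNReal.rpow_mul]
      norm_num

theorem tsum_dual_eq_zero {s n : ℕ} (hn : n ≠ 0) (z : Fin s → ℕ)
    {b : (Fin s → ℤ) → ℂ} {g : UnitAddTorus (Fin s) → ℂ}
    (hg : ∀ y, HasSum (fun h => b h * UnitAddTorus.mFourier h y) (g y))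
    (hg0 : ∀ k, g (latticePoint n z k) = 0) (h : Fin s → ℤ) :
    HasSum (fun l : Fin s → ℤ => if (n : ℤ) ∣ ∑ j, l j * (z j : ℤ) then b (h + l) else 0) 0 := by
  have : NeZero n := ⟨hn⟩
  have h1 := hasSum_sum fun k (_ : k ∈ Finset.univ) =>
    (hg (latticePoint n z k)).mul_left (UnitAddTorus.mFourier (-h) (latticePoint n z k) * (n : ℂ)⁻¹)
  simp only [hg0, mul_zero, Finset.sum_const_zero] at h1
  rw [← (Equiv.addLeft h).hasSum_iff] at h1
  refine h1.congr_fun fun l => ?_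
  have e : ∀ k, UnitAddTorus.mFourier (-h) (latticePoint n z k) * (n : ℂ)⁻¹ *
      (b (h + l) * UnitAddTorus.mFourier (h + l) (latticePoint n z k)) =
      b (h + l) * (n : ℂ)⁻¹ * UnitAddTorus.mFourier l (latticePoint n z k) := fun k => by
    have : UnitAddTorus.mFourier l (latticePoint n z k) =
        UnitAddTorus.mFourier (-h) (latticePoint n z k) *
        UnitAddTorus.mFourier (h + l) (latticePoint n z k) := by
      rw [← UnitAddTorus.mFourier_add, neg_add_cancel_left]
    rw [this]
    ring
  simp only [Function.comp_apply, Equiv.coe_addLeft, e]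
  rw [← Finset.mul_sum, sum_mFourier_latticePoint]
  have hn' : (n : ℂ) ≠ 0 := by exact_mod_cast hn
  split_ifs
  · field_simp
  · simp

theorem enorm_coeff_le {s n : ℕ} (hn : n ≠ 0) (z : Fin s → ℕ)
    {b : (Fin s → ℤ) → ℂ} {g : UnitAddTorus (Fin s) → ℂ}
    (hg : ∀ y, HasSum (fun h => b h * UnitAddTorus.mFourier h y) (g y))
    (hg0 : ∀ k, g (latticePoint n z k) = 0) (h : Fin s → ℤ) :
    ‖b h‖ₑ ≤ ∑' l : {l : Fin s → ℤ // IsDual n z l}, ‖b (h + l)‖ₑ := by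
  classical
  have h1 := tsum_dual_eq_zero hn z hg hg0 h
  have h2 := h1.summable.tsum_eq_add_tsum_ite 0
  rw [h1.tsum_eq] at h2
  simp only [Pi.zero_apply, zero_mul, Finset.sum_const_zero, dvd_zero, if_true, add_zero] at h2
  rw [eq_neg_of_add_eq_zero_left h2.symm, enorm_neg, tsum_subtype_pred (IsDual n z)
    fun l => ‖b (h + l)‖ₑ]
  refine (enorm_tsum_le_tsum_enorm).trans (ENNReal.tsum_le_tsum fun l => ?_)
  by_cases hl : l = 0
  · simp [hl]
  by_cases hd : (n : ℤ) ∣ ∑ j, l j * (z j : ℤ)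
  · rw [Set.indicator_of_mem (show l ∈ {l | IsDual n z l} from ⟨hl, hd⟩)]
    simp [hl, hd]
  · simp [hl, hd]

theorem sq_tsum_enorm_sq_le {α : ℝ} {γ : Finset ℕ → ℝ} (hγ : ∀ u, 0 < γ u) {s n : ℕ} (hn : n ≠ 0)
    (z : Fin s → ℕ) {b : (Fin s → ℤ) → ℂ} {g : UnitAddTorus (Fin s) → ℂ}
    (hg : ∀ y, HasSum (fun h => b h * UnitAddTorus.mFourier h y) (g y))
    (hg0 : ∀ k, g (latticePoint n z k) = 0)
    (hb1 : ∑' h, ENNReal.ofReal (r α γ h) * ‖b h‖ₑ ^ 2 ≤ 1) :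
    (∑' h, ‖b h‖ₑ ^ 2) ^ 2 ≤ searchCriterion α γ n z := by
  let w : (Fin s → ℤ) → ℝ≥0∞ := fun h => ENNReal.ofReal √(r α γ h)
  let w' : (Fin s → ℤ) → ℝ≥0∞ := fun h => ENNReal.ofReal (√(r α γ h))⁻¹
  have hw : ∀ h : Fin s → ℤ, w h ^ 2 = ENNReal.ofReal (r α γ h) := fun h => by
    rw [← ENNReal.ofReal_pow (Real.sqrt_nonneg _), Real.sq_sqrt (r_pos α hγ h).le]
  have hw' : ∀ h : Fin s → ℤ, w' h ^ 2 = ENNReal.ofReal (r α γ h)⁻¹ := fun h => by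
    rw [← ENNReal.ofReal_pow (inv_nonneg.mpr (Real.sqrt_nonneg _)), inv_pow,
      Real.sq_sqrt (r_pos α hγ h).le]
  have hww : ∀ h : Fin s → ℤ, w h * w' h = 1 := fun h => by
    rw [← ENNReal.ofReal_mul (Real.sqrt_nonneg _),
      mul_inv_cancel₀ (Real.sqrt_pos.mpr (r_pos α hγ h)).ne', ENNReal.ofReal_one]
  have hcoeff : ∀ h : Fin s → ℤ, ‖b h‖ₑ ^ 2 ≤
      ∑' l : {l : Fin s → ℤ // IsDual n z l}, ENNReal.ofReal (r α γ (h + l.1))⁻¹ := fun h => by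
    calc ‖b h‖ₑ ^ 2
        ≤ (∑' l : {l : Fin s → ℤ // IsDual n z l}, ‖b (h + l)‖ₑ) ^ 2 :=
          pow_le_pow_left' (enorm_coeff_le hn z hg hg0 h) 2
      _ = (∑' l : {l : Fin s → ℤ // IsDual n z l},
            (w (h + l) * ‖b (h + l)‖ₑ) * w' (h + l)) ^ 2 := by
          congr 1
          exact tsum_congr fun l => by rw [mul_right_comm, hww, one_mul]
      _ ≤ (∑' l : {l : Fin s → ℤ // IsDual n z l}, (w (h + l) * ‖b (h + l)‖ₑ) ^ 2) *
            ∑' l : {l : Fin s → ℤ // IsDual n z l}, w' (h + l) ^ 2 := sq_tsum_mul_le _ _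
      _ ≤ 1 * ∑' l : {l : Fin s → ℤ // IsDual n z l}, w' (h + l) ^ 2 := by
          gcongr
          refine le_trans ?_ hb1
          simp_rw [mul_pow, hw]
          exact ENNReal.tsum_comp_le_tsum_of_injective (f := fun l : {l // IsDual n z l} => h + l.1)
            (fun l l' hl => Subtype.ext (add_left_cancel hl))
            fun m => ENNReal.ofReal (r α γ m) * ‖b m‖ₑ ^ 2
      _ = _ := by simp_rw [one_mul, hw']
  calc (∑' h, ‖b h‖ₑ ^ 2) ^ 2
      = (∑' h, (w h * ‖b h‖ₑ) * (w' h * ‖b h‖ₑ)) ^ 2 := by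
        congr 1
        refine tsum_congr fun h => ?_
        calc ‖b h‖ₑ ^ 2 = (w h * w' h) * ‖b h‖ₑ ^ 2 := by rw [hww, one_mul]
          _ = _ := by ring
    _ ≤ (∑' h, (w h * ‖b h‖ₑ) ^ 2) * ∑' h, (w' h * ‖b h‖ₑ) ^ 2 := sq_tsum_mul_le _ _
    _ ≤ 1 * searchCriterion α γ n z := by
        gcongr
        · simpa only [mul_pow, hw] using hb1
        · refine ENNReal.tsum_le_tsum fun h => ?_
          simp_rw [ENNReal.ofReal_mul (inv_pos.mpr (r_pos α hγ h)).le]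
          rw [mul_pow, hw', ENNReal.tsum_mul_left]
          gcongr
          exact hcoeff h
    _ = _ := one_mul _

/-- The interpolation error has norm at most that of the interpolated function. -/
theorem tsum_r_mul_sq_sub_interpCoeff_le {α : ℝ} (hα : 1 < α) {γ : Finset ℕ → ℝ}
    (hγ : ∀ u, 0 < γ u) {s n : ℕ} (z : Fin s → ℕ) {f : UnitAddTorus (Fin s) → ℝ}
    (hf : MemH α γ f) (hf1 : normH α γ f ≤ 1) (a : Fin n → ℝ)
    (hfa : ∀ k', ∑ k, a k * kernel α γ (latticePoint n z k) (latticePoint n z k') =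
      f (latticePoint n z k')) :
    ∑' h, ENNReal.ofReal (r α γ h) * ‖fhat f h - interpCoeff α γ n z a h‖ₑ ^ 2 ≤ 1 := by
  set p := interpCoeff α γ n z a with hp
  have h1 : HasSum (fun h => r α γ h * ((fhat f h - p h) * conj (p h)).re) 0 := by
    have h2 := hasSum_sum fun k (_ : k ∈ Finset.univ) =>
      ((hf.hasSum_fourier (latticePoint n z k)).sub
        (hasSum_interpCoeff hα γ n z a (latticePoint n z k))).mul_left (a k : ℂ)
    simp only [hfa, sub_self, mul_zero, Finset.sum_const_zero] at h2
    have h3 := Complex.hasSum_re h2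
    rw [Complex.zero_re] at h3
    refine h3.congr_fun fun h => ?_
    rw [← Complex.re_ofReal_mul]
    congr 1
    have hr : (r α γ h : ℂ) ≠ 0 := by exact_mod_cast (r_pos α hγ h).ne'
    have e : (r α γ h : ℂ) * conj (p h) =
        ∑ k, (a k : ℂ) * UnitAddTorus.mFourier h (latticePoint n z k) := by
      simp only [hp, interpCoeff, map_mul, map_sum, Complex.conj_ofReal, Complex.conj_conj]
      rw [Complex.ofReal_inv, mul_inv_cancel_left₀ hr]
    rw [mul_left_comm, e, Finset.mul_sum]
    exact Finset.sum_congr rfl fun k _ => by ring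
  have h2 := hf.summable_norm.hasSum.sub (h1.mul_left 2)
  rw [mul_zero, sub_zero] at h2
  have hle : ∀ h, r α γ h * ‖fhat f h - p h‖ ^ 2 ≤
      r α γ h * ‖fhat f h‖ ^ 2 - 2 * (r α γ h * ((fhat f h - p h) * conj (p h)).re) := fun h => by
    have e : ‖fhat f h‖ ^ 2 = ‖fhat f h - p h‖ ^ 2 + ‖p h‖ ^ 2 +
        2 * ((fhat f h - p h) * conj (p h)).re := by
      have := Complex.normSq_add (fhat f h - p h) (p h)
      rw [sub_add_cancel] at this
      simpa only [Complex.normSq_eq_norm_sq] using this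
    have h0 := mul_nonneg (r_pos α hγ h).le (sq_nonneg ‖p h‖)
    rw [e]
    linarith
  have hnn : ∀ h, 0 ≤ r α γ h * ‖fhat f h - p h‖ ^ 2 := fun h =>
    mul_nonneg (r_pos α hγ h).le (sq_nonneg _)
  have hs : Summable fun h => r α γ h * ‖fhat f h - p h‖ ^ 2 :=
    Summable.of_nonneg_of_le hnn hle h2.summable
  have h4 : ∑' h, r α γ h * ‖fhat f h - p h‖ ^ 2 ≤ 1 := by
    refine (hs.tsum_le_tsum hle h2.summable).trans ?_
    rw [h2.tsum_eq]
    exact Real.sqrt_le_one.mp hf1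
  calc _ = ENNReal.ofReal (∑' h, r α γ h * ‖fhat f h - p h‖ ^ 2) := by
        rw [ENNReal.ofReal_tsum_of_nonneg hnn hs]
        exact tsum_congr fun h => by
          rw [ENNReal.ofReal_mul (r_pos α hγ h).le, ENNReal.ofReal_pow (norm_nonneg _), ofReal_norm]
    _ ≤ 1 := by simpa using ENNReal.ofReal_le_ofReal h4

theorem worstCaseError_le {α : ℝ} (hα : 1 < α) {γ : Finset ℕ → ℝ} (hγ : ∀ u, 0 < γ u)
    {s n : ℕ} (hs : 1 ≤ s) (hn : n.Prime) {z : Fin s → ℕ}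
    (hz : ∀ j, z j ∈ Finset.Icc 1 (n - 1)) :
    worstCaseError α γ (kernelInterpolant α γ n z) ≤ searchCriterion α γ n z ^ (1 / 4 : ℝ) := by
  refine iSup_le fun f => iSup_le fun hf => iSup_le fun hf1 => ?_
  set a := (kernelMatrix α γ n z)⁻¹.mulVec fun k' => f (latticePoint n z k') with ha
  have hfa := kernelInterpolant_apply_latticePoint hα hγ hs hn hz f
  have hb : Summable fun h => ‖fhat f h - interpCoeff α γ n z a h‖ :=
    Summable.of_nonneg_of_le (fun _ => norm_nonneg _) (fun h => norm_sub_le _ _)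
      (hf.summable_fhat.add (summable_interpCoeff hα hγ n z a))
  have hg : ∀ y, HasSum (fun h => (fhat f h - interpCoeff α γ n z a h) * UnitAddTorus.mFourier h y)
      ((f y - kernelInterpolant α γ n z f y : ℝ) : ℂ) := fun y => by
    have := (hf.hasSum_fourier y).sub (hasSum_interpCoeff hα γ n z a y)
    simp only [sub_mul, Complex.ofReal_sub]
    exact this
  have h1 := eLpNorm_sq_eq_tsum (g := fun y => f y - kernelInterpolant α γ n z f y) hb hg
  have h2 := sq_tsum_enorm_sq_le hγ hn.ne_zero z hg (fun k => by simp [hfa k])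
    (tsum_r_mul_sq_sub_interpCoeff_le hα hγ z hf hf1 a hfa)
  rw [← h1, ← pow_mul] at h2
  rw [one_div, ENNReal.le_rpow_inv_iff (by norm_num)]
  exact_mod_cast h2

theorem weightTerm_nonneg (α : ℝ) {γ : Finset ℕ → ℝ} (hγ : ∀ u, 0 < γ u) (lam : ℝ)
    (u : Finset ℕ) : 0 ≤ weightTerm α γ lam u :=
  mul_nonneg (mul_nonneg (Nat.cast_nonneg _) (Real.rpow_nonneg (hγ u).le _))
    (pow_nonneg (mul_nonneg zero_le_two (zeta_nonneg _)) _)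

theorem kappa_nonneg (α lam : ℝ) : 0 ≤ kappa α lam := by
  unfold kappa
  positivity

theorem IsCBC.sqrt_two_mul_searchCriterion_le {α : ℝ} {γ : Finset ℕ → ℝ} (hγ : ∀ u, 0 < γ u)
    {lam : ℝ} (hl : 0 < lam) (hl1 : lam ≤ 1) (hx : 1 < α * lam) {s n : ℕ} (hn : n.Prime)
    {z : Fin s → ℕ} (hz : IsCBC α γ n z) :
    ENNReal.ofReal √2 * searchCriterion α γ n z ^ (1 / 4 : ℝ) ≤
      ENNReal.ofReal (kappa α lam / (n : ℝ) ^ (1 / (4 * lam)) *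
        (∑ u ∈ (Finset.range s).powerset, weightTerm α γ lam u) ^ (1 / (2 * lam))) := by
  set τ : ℝ := max 6 (5 / 2 + 2 ^ (2 * α * lam + 1)) with hτ
  set W : ℝ := ∑ u ∈ (Finset.range s).powerset, weightTerm α γ lam u with hW
  have hτ0 : 0 ≤ τ := le_trans (by norm_num) (le_max_left _ _)
  have hW0 : 0 ≤ W := Finset.sum_nonneg fun u _ => weightTerm_nonneg α hγ lam u
  have hn0 : (0 : ℝ) < n := by exact_mod_cast hn.pos
  have h1 := hz.searchCriterion_rpow_le hγ hl hl1 hx hn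
  rw [← ENNReal.ofReal_sum_of_nonneg fun u _ => weightTerm_nonneg α hγ lam u,
    ← ENNReal.ofReal_natCast, ← ENNReal.ofReal_inv_of_pos hn0, ← ENNReal.ofReal_mul hτ0,
    ← ENNReal.ofReal_pow hW0, ← ENNReal.ofReal_mul (by positivity)] at h1
  have h2 := ENNReal.rpow_le_rpow h1 (by positivity : 0 ≤ 1 / (4 * lam))
  rw [← ENNReal.rpow_mul, show lam * (1 / (4 * lam)) = 1 / 4 by field_simp,
    ENNReal.ofReal_rpow_of_nonneg (by positivity) (by positivity)] at h2
  refine (mul_le_mul_right h2 _).trans_eq ?_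
  rw [← ENNReal.ofReal_mul (Real.sqrt_nonneg _)]
  congr 1
  rw [Real.mul_rpow (by positivity) (by positivity), Real.mul_rpow hτ0 (by positivity),
    Real.inv_rpow hn0.le, ← Real.rpow_natCast W 2, ← Real.rpow_mul hW0,
    show ((2 : ℕ) : ℝ) * (1 / (4 * lam)) = 1 / (2 * lam) by push_cast; field_simp; norm_num, kappa,
    ← hτ]
  ring

theorem IsCBC.worstCaseError_le_sqrt_two {α : ℝ} (hα : 1 < α) {γ : Finset ℕ → ℝ}
    (hγ : ∀ u, 0 < γ u) {s n : ℕ} (hs : 1 ≤ s) (hn : n.Prime) {z : Fin s → ℕ}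
    (hz : IsCBC α γ n z) :
    worstCaseError α γ (kernelInterpolant α γ n z) ≤
      ENNReal.ofReal √2 * searchCriterion α γ n z ^ (1 / 4 : ℝ) := by
  refine (worstCaseError_le hα hγ hs hn fun j => (hz j).1).trans ?_
  refine le_mul_of_one_le_left zero_le ?_
  rw [← ENNReal.ofReal_one]
  exact ENNReal.ofReal_le_ofReal (Real.one_le_sqrt.mpr one_le_two)

/-- The rate of convergence for the exponent `λ_δ`, with any bound `B` on the sum of weights. -/
theorem IsCBC.worstCaseError_le_rpow {α : ℝ} (hα : 1 < α) {γ : Finset ℕ → ℝ}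
    (hγ : ∀ u, 0 < γ u) {δ : ℝ} (hδ : 0 < δ) (hδα : δ < α / 4) {B : ℝ} {s : ℕ} (hs : 1 ≤ s)
    (hB : ∑ u ∈ (Finset.range s).powerset, weightTerm α γ (min (1 / (α - 4 * δ)) 1) u ≤ B)
    {n : ℕ} (hn : n.Prime) {z : Fin s → ℕ} (hz : IsCBC α γ n z) :
    worstCaseError α γ (kernelInterpolant α γ n z) ≤
      ENNReal.ofReal (kappa α (min (1 / (α - 4 * δ)) 1) *
        B ^ (1 / (2 * min (1 / (α - 4 * δ)) 1)) * (n : ℝ) ^ (-α / 4 + δ)) := by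
  have hpos : 0 < α - 4 * δ := by linarith
  set lam := min (1 / (α - 4 * δ)) 1 with hlam
  have hl : 0 < lam := lt_min (by positivity) one_pos
  have hx : 1 < α * lam := by
    rw [hlam, mul_min_of_nonneg _ _ (by linarith), lt_min_iff, mul_one_div, lt_div_iff₀ hpos]
    constructor <;> linarith
  have hexp : α / 4 - δ ≤ 1 / (4 * lam) := by
    have h1 : lam * (α - 4 * δ) ≤ 1 := by
      rw [← le_div_iff₀ hpos]
      exact min_le_left _ _
    rw [le_div_iff₀ (by positivity)]
    linarith
  have hn1 : (1 : ℝ) ≤ n := by exact_mod_cast hn.one_le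
  refine (hz.worstCaseError_le_sqrt_two hα hγ hs hn).trans
    ((hz.sqrt_two_mul_searchCriterion_le hγ hl (min_le_right _ _) hx hn).trans
      (ENNReal.ofReal_le_ofReal ?_))
  have hW0 : 0 ≤ ∑ u ∈ (Finset.range s).powerset, weightTerm α γ lam u :=
    Finset.sum_nonneg fun u _ => weightTerm_nonneg α hγ lam u
  have hk := kappa_nonneg α lam
  have hB0 : 0 ≤ B := hW0.trans hB
  have hpow : ((n : ℝ) ^ (1 / (4 * lam)))⁻¹ ≤ (n : ℝ) ^ (-α / 4 + δ) := by
    rw [← Real.rpow_neg (by linarith)]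
    exact Real.rpow_le_rpow_of_exponent_le hn1 (by linarith)
  calc _ = kappa α lam * (∑ u ∈ (Finset.range s).powerset, weightTerm α γ lam u) ^ (1 / (2 * lam)) *
        ((n : ℝ) ^ (1 / (4 * lam)))⁻¹ := by ring
    _ ≤ _ := by gcongr

end LatticeKernel

theorem mainTheorem4 (α : ℝ) (hα : 1 < α) (γ : Finset ℕ → ℝ) (hγ : ∀ u, 0 < γ u)
    (hγ0 : γ ∅ = 1) :
    (∀ s : ℕ, 1 ≤ s → ∀ n : ℕ, n.Prime → ∀ z : Fin s → ℕ, LatticeKernel.IsCBC α γ n z →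
      -- the kernel interpolant is well defined
      (∀ f : UnitAddTorus (Fin s) → ℝ, LatticeKernel.MemH α γ f →
        ∀ g : UnitAddTorus (Fin s) → ℝ, LatticeKernel.IsKernelInterpolant α γ n z f g ↔
          g = LatticeKernel.kernelInterpolant α γ n z f) ∧
      LatticeKernel.worstCaseError α γ (LatticeKernel.kernelInterpolant α γ n z) ≤
        ENNReal.ofReal √2 * LatticeKernel.searchCriterion α γ n z ^ (1 / 4 : ℝ) ∧
      ∀ lam : ℝ, 1 / α < lam → lam ≤ 1 →
        ENNReal.ofReal √2 * LatticeKernel.searchCriterion α γ n z ^ (1 / 4 : ℝ) ≤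
          ENNReal.ofReal (LatticeKernel.kappa α lam / (n : ℝ) ^ (1 / (4 * lam)) *
            (∑ u ∈ (Finset.range s).powerset, LatticeKernel.weightTerm α γ lam u) ^
              (1 / (2 * lam)))) ∧
    (∀ δ : ℝ, 0 < δ → δ < α / 4 →
      -- the rate in every fixed dimension
      (∀ s : ℕ, 1 ≤ s → ∃ C : ℝ, ∀ n : ℕ, n.Prime → ∀ z : Fin s → ℕ,
        LatticeKernel.IsCBC α γ n z →
        LatticeKernel.worstCaseError α γ (LatticeKernel.kernelInterpolant α γ n z) ≤
          ENNReal.ofReal (C * (n : ℝ) ^ (-α / 4 + δ))) ∧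
      -- the rate with a constant that does not depend on the dimension
      (Summable (LatticeKernel.weightTerm α γ (min (1 / (α - 4 * δ)) 1)) →
        ∃ C : ℝ, ∀ s : ℕ, 1 ≤ s → ∀ n : ℕ, n.Prime → ∀ z : Fin s → ℕ,
          LatticeKernel.IsCBC α γ n z →
          LatticeKernel.worstCaseError α γ (LatticeKernel.kernelInterpolant α γ n z) ≤
            ENNReal.ofReal (C * (n : ℝ) ^ (-α / 4 + δ)))) := by
  refine ⟨fun s hs n hn z hz => ⟨fun f _ g => ?_, ?_, fun lam hlam hlam1 => ?_⟩,
    fun δ hδ hδα => ⟨fun s hs => ?_, fun hsum => ?_⟩⟩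
  · exact LatticeKernel.isKernelInterpolant_iff hα hγ hs hn (fun j => (hz j).1) f g
  · exact hz.worstCaseError_le_sqrt_two hα hγ hs hn
  · have hα0 : 0 < α := by linarith
    have hl : 0 < lam := lt_trans (by positivity) hlam
    exact hz.sqrt_two_mul_searchCriterion_le hγ hl hlam1
      (by rwa [div_lt_iff₀ hα0, mul_comm] at hlam) hn
  · exact ⟨_, fun n hn z hz => hz.worstCaseError_le_rpow hα hγ hδ hδα hs le_rfl hn⟩
  · exact ⟨_, fun s hs n hn z hz => hz.worstCaseError_le_rpow hα hγ hδ hδα hs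
      (hsum.sum_le_tsum _ fun u _ => LatticeKernel.weightTerm_nonneg α hγ _ u) hn⟩
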